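/- Let $N\ge 1$, $a\in(-1,1)$, $\mathbb N=\{0,1,2,\dots\}$. Write $X=(x,y)\in\mathbb R^{N}\times\mathbb R$, $\mathbb R^{N+1}_+=\{y>0\}$, and $\mathcal G_a(X)=\frac{1}{2^a\Gamma(\frac{1+a}{2})(4\pi)^{N/2}}\,e^{-|X|^2/4}$. Consider the probability measures $d\mu=y^a\mathcal G_a\,dX$ on $\mathbb R^{N+1}_+$ and $d\mu=\frac12|y|^a\mathcal G_a\,dX$ on $\mathbb R^{N+1}$. Let $H^1(\mathbb R^{N+1}_+,d\mu)$, $H^1_0(\mathbb R^{N+1}_+,d\mu)$ and $H^1(\mathbb R^{N+1},d\mu)$ be the closures of $C_c^\infty(\overline{\mathbb R^{N+1}_+})$, $C_c^\infty(\mathbb R^{N+1}_+)$ and $C_c^\infty(\mathbb R^{N+1})$ respectively for the norm $\left(\int V^2\,d\mu+\int|\nabla V|^2\,d\mu\right)^{1/2}$. Let $\mathcal H$ be one of these three spaces. A real number $\kappa$ is an eigenvalue, and $V\in\mathcal H$, $V\neq0$, is an eigenfunction for $\kappa$, if $$\int\nabla V\cdot\nabla\eta\,d\mu=\kappa\int V\eta\,d\mu\qquad\text{for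 all }\eta\in\mathcal H.$$ This is the weak form of the following problem. On the half-space it is $-\mathcal O_aV=\kappa V$, where $\mathcal O_aV=\frac{1}{y^a\mathcal G_a}\nabla\cdot(y^a\mathcal G_a\nabla V)$, with the Neumann condition $\lim_{y\to0^+}y^a\partial_yV=0$ if $\mathcal H=H^1(\mathbb R^{N+1}_+,d\mu)$, and with the Dirichlet condition $V=0$ on $\{y=0\}$ if $\mathcal H=H^1_0(\mathbb R^{N+1}_+,d\mu)$. If $\mathcal H=H^1(\mathbb R^{N+1},d\mu)$ it is the whole-space problem $-\frac{1}{|y|^a\mathcal G_a}\nabla\cdot(|y|^a\mathcal G_a\nabla V)=\kappa V$. The eigenspace of $\kappa$ consists of $0$ and the eigenfunctions for $\kappa$. For $\alpha=(\alpha_1,\dots,\alpha_N)\in\mathbb N^N$ put $|\alpha|=\alpha_1+\dots+\alpha_N$ and $H_\alpha(x)=\prod_{i=1}^N H_{\alpha_i}(x_i)$, where $H_n(t)=2^{n/2}\mathrm{He}_n(t/\sqrt2)$ and $\mathrm{He}_n$ is the probabilists' Hermite polynomial (so $H_0=1$, $H_1=t$, $H_2=t^2-2$). Let $L_{(s),m}(r)=\sum_{j=0}^m(-1)^j\binom{m+s}{m-j}\frac{r^j}{j!}$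 be the $m$-th Laguerre polynomial of order $s$. Put $$\widetilde\kappa_{n,m}=\frac n2+m,\qquad \widehat\kappa_{n,m}=\frac n2+m+\frac{1-a}2\qquad(n,m\in\mathbb N).$$ (i) Neumann problem. The set of eigenvalues is $\{\widetilde\kappa_{n,m}:n,m\in\mathbb N\}$ and all eigenspaces are finite-dimensional. With $\widetilde V_{\alpha,m}(x,y)=H_\alpha(x)L_{(\frac{a-1}2),m}(y^2/4)$, the eigenspace of $\widetilde\kappa_{n_0,m_0}$ is $\operatorname{span}\{\widetilde V_{\alpha,m}:\widetilde\kappa_{|\alpha|,m}=\widetilde\kappa_{n_0,m_0}\}$ for all $n_0,m_0\in\mathbb N$. The family $\{\widetilde V_{\alpha,m}\}_{(\alpha,m)\in\mathbb N^N\times\mathbb N}$ is an orthogonal basis of $L^2(\mathbb R^{N+1}_+,d\mu)$. (ii) Dirichlet problem. The set of eigenvalues is $\{\widehat\kappa_{n,m}:n,m\in\mathbb N\}$ and all eigenspaces are finite-dimensional. With $V_{\alpha,m}(x,y)=H_\alpha(x)\,y^{1-a}L_{(\frac{1-a}2),m}(y^2/4)$, the eigenspace of $\widehat\kappa_{n_0,m_0}$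 is $\operatorname{span}\{V_{\alpha,m}:\widehat\kappa_{|\alpha|,m}=\widehat\kappa_{n_0,m_0}\}$ for all $n_0,m_0\in\mathbb N$. The family $\{V_{\alpha,m}\}_{(\alpha,m)\in\mathbb N^N\times\mathbb N}$ is an orthogonal basis of $L^2(\mathbb R^{N+1}_+,d\mu)$. (iii) Whole-space problem. The set of eigenvalues is $\{\widehat\kappa_{n,m}:n,m\in\mathbb N\}\cup\{\widetilde\kappa_{n,m}:n,m\in\mathbb N\}$ and all eigenspaces are finite-dimensional. Let $\widetilde V_{\alpha,m}$ be given on $\mathbb R^{N+1}$ by the formula in (i), and let $\widehat V_{\alpha,m}(x,y)=H_\alpha(x)\,y|y|^{-a}L_{(\frac{1-a}2),m}(y^2/4)$. For every $\kappa\in\mathbb R$ the eigenspace of $\kappa$ (which is $\{0\}$ if $\kappa$ is not an eigenvalue) is $$\operatorname{span}\{\widetilde V_{\alpha,m}:\widetilde\kappa_{|\alpha|,m}=\kappa\}+\operatorname{span}\{\widehat V_{\alpha,m}:\widehat\kappa_{|\alpha|,m}=\kappa\}.$$ In particular, if $a\neq0$, then for all $n_0,m_0\in\mathbb N$ the eigenspace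 of $\widetilde\kappa_{n_0,m_0}$ is $\operatorname{span}\{\widetilde V_{\alpha,m}:\widetilde\kappa_{|\alpha|,m}=\widetilde\kappa_{n_0,m_0}\}$ and that of $\widehat\kappa_{n_0,m_0}$ is $\operatorname{span}\{\widehat V_{\alpha,m}:\widehat\kappa_{|\alpha|,m}=\widehat\kappa_{n_0,m_0}\}$. The family $\{\widetilde V_{\alpha,m}\}\cup\{\widehat V_{\alpha,m}\}$, with $(\alpha,m)\in\mathbb N^N\times\mathbb N$, is an orthogonal basis of $L^2(\mathbb R^{N+1},d\mu)$. -/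

import Mathlib

open MeasureTheory
open scoped ContDiff

noncomputable section

namespace OrnsteinUhlenbeck

/-- The space `ℝ^{N+1}` of points `X = (x, y)`, with `x ∈ ℝ^N` the first `N` coordinates and
`y ∈ ℝ` the last one. -/
abbrev Space (N : ℕ) : Type := EuclideanSpace ℝ (Fin (N + 1))

/-- The last coordinate `y` of `X = (x, y)`. -/
def yCoord {N : ℕ} (X : Space N) : ℝ := X (Fin.last N)

/-- The `i`-th coordinate of `x`, where `X = (x, y)`. -/
def xCoord {N : ℕ} (X : Space N) (i : Fin N) : ℝ := X i.castSucc

/-- The open half-space `ℝ^{N+1}_+ = {y > 0}`. -/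
def upperHalf (N : ℕ) : Set (Space N) := {X | 0 < yCoord X}

/-- The fundamental solution at time one,
`𝒢_a(X, 1) = e^{-|X|²/4} / (2^a Γ((1+a)/2) (4π)^{N/2})`. -/
def fundSol {N : ℕ} (a : ℝ) (X : Space N) : ℝ :=
  1 / ((2 : ℝ) ^ a * Real.Gamma ((1 + a) / 2) * (4 * Real.pi) ^ ((N : ℝ) / 2)) *
    Real.exp (-‖X‖ ^ 2 / 4)

/-- The measure `dμ = y^a 𝒢_a(X, 1) dX` on the half-space `{y > 0}` (regarded as a measure on
`ℝ^{N+1}` carried by the half-space). -/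
def muHalf (N : ℕ) (a : ℝ) : Measure (Space N) :=
  (volume.restrict (upperHalf N)).withDensity
    (fun X => ENNReal.ofReal (yCoord X ^ a * fundSol a X))

/-- The measure `dμ = |y|^a (𝒢_a(X, 1) / 2) dX` on the whole space `ℝ^{N+1}`. -/
def muWhole (N : ℕ) (a : ℝ) : Measure (Space N) :=
  volume.withDensity (fun X => ENNReal.ofReal (|yCoord X| ^ a * (fundSol a X / 2)))

/-- Smooth functions on `ℝ^{N+1}` with compact support contained in `U`. -/
def testFunctions {N : ℕ} (U : Set (Space N)) : Submodule ℝ (Space N → ℝ) where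
  carrier := {φ | ContDiff ℝ ∞ φ ∧ HasCompactSupport φ ∧ tsupport φ ⊆ U}
  zero_mem' := ⟨contDiff_const, HasCompactSupport.zero, by
    rw [tsupport_eq_empty_iff.mpr rfl]; exact Set.empty_subset _⟩
  add_mem' := fun {φ ψ} hφ hψ => ⟨hφ.1.add hψ.1, hφ.2.1.add hψ.2.1,
    (tsupport_add φ ψ).trans (Set.union_subset hφ.2.2 hψ.2.2)⟩
  smul_mem' := fun c φ hφ => ⟨contDiff_const.smul hφ.1, hφ.2.1.smul_left (f := fun _ => c),
    (tsupport_smul_subset_right (fun _ => c) φ).trans hφ.2.2⟩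

/-- The graph `{(φ, ∇φ)}` of the gradient on the test functions with support in `U`, as a
subspace of `L²(μ) × L²(μ; ℝ^{N+1})`. -/
def gradientGraph {N : ℕ} (μ : Measure (Space N)) (U : Set (Space N)) :
    Submodule ℝ (Lp ℝ 2 μ × Lp (Space N) 2 μ) where
  carrier := {p | ∃ φ ∈ testFunctions U, p.1 =ᵐ[μ] φ ∧ p.2 =ᵐ[μ] gradient φ}
  zero_mem' := ⟨0, zero_mem _, Lp.coeFn_zero _ _ _, by
    filter_upwards [Lp.coeFn_zero (Space N) 2 μ] with X hX
    have h : gradient (0 : Space N → ℝ) X = 0 := gradient_const X 0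
    rw [h]; exact hX⟩
  add_mem' := by
    rintro p q ⟨φ, hφ, hp1, hp2⟩ ⟨ψ, hψ, hq1, hq2⟩
    refine ⟨φ + ψ, add_mem hφ hψ, (Lp.coeFn_add _ _).trans (hp1.add hq1), ?_⟩
    filter_upwards [Lp.coeFn_add p.2 q.2, hp2, hq2] with X h1 h2 h3
    have hd1 : DifferentiableAt ℝ φ X := (hφ.1.differentiable (by simp)).differentiableAt
    have hd2 : DifferentiableAt ℝ ψ X := (hψ.1.differentiable (by simp)).differentiableAt
    have h : gradient (φ + ψ) X = gradient φ X + gradient ψ X := by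
      simp only [gradient, fderiv_add hd1 hd2, map_add]
    rw [h, ← h2, ← h3]; exact h1
  smul_mem' := by
    rintro c p ⟨φ, hφ, hp1, hp2⟩
    refine ⟨c • φ, Submodule.smul_mem _ c hφ,
      (Lp.coeFn_smul _ _).trans (hp1.const_smul c), ?_⟩
    filter_upwards [Lp.coeFn_smul c p.2, hp2] with X h1 h2
    have hd : DifferentiableAt ℝ φ X := (hφ.1.differentiable (by simp)).differentiableAt
    have h : gradient (c • φ) X = c • gradient φ X := by
      simp only [gradient, fderiv_const_smul hd, map_smul]
    rw [h, ← h2]; exact h1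

/-- The weighted Sobolev space obtained as the closure of the test functions with support in `U`
for the norm `(∫ V² dμ + ∫ |∇V|² dμ)^{1/2}`. An element is recorded as the pair `(V, ∇V)` in
`L²(μ) × L²(μ; ℝ^{N+1})`, so the space is the closure of the graph of the gradient.
* `sobolev (muHalf N a) univ` is `H¹(ℝ^{N+1}_+, dμ)`, since the elements of
  `C_c^∞` of the closed half-space are the restrictions of elements of `C_c^∞(ℝ^{N+1})`;
* `sobolev (muHalf N a) (upperHalf N)` is `H¹_0(ℝ^{N+1}_+, dμ)`;
* `sobolev (muWhole N a) univ` is `H¹(ℝ^{N+1}, dμ)`. -/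
def sobolev {N : ℕ} (μ : Measure (Space N)) (U : Set (Space N)) :
    Submodule ℝ (Lp ℝ 2 μ × Lp (Space N) 2 μ) :=
  (gradientGraph μ U).topologicalClosure

/-- The weak eigenspace for `κ`: all `V` in the Sobolev space, with gradient `G = ∇V`, such that
`∫ ∇V · ∇η dμ = κ ∫ V η dμ` for all `η` in the same Sobolev space. Both integrals are written as
inner products of the spaces `L²(μ; ℝ^{N+1})` and `L²(μ)`; here `q = (η, ∇η)`. -/
def weakEigenspace {N : ℕ} (μ : Measure (Space N)) (U : Set (Space N)) (κ : ℝ) :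
    Submodule ℝ (Lp ℝ 2 μ) where
  carrier := {V | ∃ G : Lp (Space N) 2 μ, (V, G) ∈ sobolev μ U ∧
    ∀ q ∈ sobolev μ U, inner ℝ G q.2 = κ * inner ℝ V q.1}
  zero_mem' := ⟨0, zero_mem _, fun q _ => by simp⟩
  add_mem' := by
    rintro V W ⟨G, hG, hV⟩ ⟨K, hK, hW⟩
    refine ⟨G + K, add_mem hG hK, fun q hq => ?_⟩
    rw [inner_add_left, inner_add_left, hV q hq, hW q hq, mul_add]
  smul_mem' := by
    rintro c V ⟨G, hG, hV⟩
    refine ⟨c • G, Submodule.smul_mem _ c hG, fun q hq => ?_⟩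
    rw [real_inner_smul_left, real_inner_smul_left, hV q hq]; ring

/-- The set of eigenvalues: those `κ ∈ ℝ` that have a nontrivial weak eigenfunction. -/
def eigenvalues {N : ℕ} (μ : Measure (Space N)) (U : Set (Space N)) : Set ℝ :=
  {κ | ∃ V ∈ weakEigenspace μ U κ, V ≠ 0}

/-- The one-dimensional Hermite polynomial `H_n` for the weight `e^{-x²/4}`, monic of degree `n`:
`H_n(x) = 2^{n/2} He_n(x / √2)`, with `He_n` the probabilists' Hermite polynomial. Thus `H_0 = 1`,
`H_1 = x`, `H_2 = x² - 2`, `H_3 = x³ - 6x`. -/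
def hermite (n : ℕ) (x : ℝ) : ℝ :=
  Real.sqrt 2 ^ n * Polynomial.aeval (x / Real.sqrt 2) (Polynomial.hermite n)

/-- The `N`-dimensional Hermite polynomial `H_α(x) = H_{α_1}(x_1) ⋯ H_{α_N}(x_N)`. -/
def hermiteMulti {N : ℕ} (α : Fin N → ℕ) (X : Space N) : ℝ :=
  ∏ i, hermite (α i) (xCoord X i)

/-- The Laguerre polynomial of order `s` and degree `m`,
`L_{(s),m}(r) = ∑_{j=0}^m (-1)^j binom(m+s, m-j) r^j / j!`, where
`binom(m+s, m-j) = (s+j+1) ⋯ (s+m) / (m-j)!`. -/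
def laguerre (s : ℝ) (m : ℕ) (r : ℝ) : ℝ :=
  ∑ j ∈ Finset.range (m + 1),
    (-1) ^ j * ((∏ i ∈ Finset.Ioc j m, (s + (i : ℝ))) / (Nat.factorial (m - j) : ℝ)) *
      (r ^ j / (Nat.factorial j : ℝ))

/-- The index set of the eigenfunctions: pairs `(α, m)` of a multi-index and an integer. -/
abbrev Index (N : ℕ) : Type := (Fin N → ℕ) × ℕ

/-- `κ̃_{n,m} = n/2 + m`. -/
def kappaN (n m : ℕ) : ℝ := (n : ℝ) / 2 + (m : ℝ)

/-- `κ̂_{n,m} = n/2 + m + (1-a)/2`. -/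
def kappaD (a : ℝ) (n m : ℕ) : ℝ := (n : ℝ) / 2 + (m : ℝ) + (1 - a) / 2

/-- All `(α, m)` with `κ̃_{|α|,m} = κ`. -/
def indexN (N : ℕ) (κ : ℝ) : Set (Index N) := {p | kappaN (∑ i, p.1 i) p.2 = κ}

/-- All `(α, m)` with `κ̂_{|α|,m} = κ`. -/
def indexD (N : ℕ) (a κ : ℝ) : Set (Index N) := {p | kappaD a (∑ i, p.1 i) p.2 = κ}

/-- `H_α(x) L_{((a-1)/2),m}(y²/4)`. -/
def eigenN {N : ℕ} (a : ℝ) (p : Index N) (X : Space N) : ℝ :=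
  hermiteMulti p.1 X * laguerre ((a - 1) / 2) p.2 (yCoord X ^ 2 / 4)

/-- `H_α(x) y^{1-a} L_{((1-a)/2),m}(y²/4)`, for `y > 0`. -/
def eigenD {N : ℕ} (a : ℝ) (p : Index N) (X : Space N) : ℝ :=
  hermiteMulti p.1 X * yCoord X ^ (1 - a) * laguerre ((1 - a) / 2) p.2 (yCoord X ^ 2 / 4)

/-- `H_α(x) y |y|^{-a} L_{((1-a)/2),m}(y²/4)`, for `y ∈ ℝ`. -/
def eigenOdd {N : ℕ} (a : ℝ) (p : Index N) (X : Space N) : ℝ :=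
  hermiteMulti p.1 X * (yCoord X * |yCoord X| ^ (-a)) *
    laguerre ((1 - a) / 2) p.2 (yCoord X ^ 2 / 4)

/-- An orthogonal basis of a Hilbert space: nonzero, pairwise orthogonal vectors with dense
linear span. -/
def IsOrthogonalBasis {ι H : Type*} [NormedAddCommGroup H] [InnerProductSpace ℝ H]
    (e : ι → H) : Prop :=
  (∀ i, e i ≠ 0) ∧ (∀ i j, i ≠ j → inner ℝ (e i) (e j) = 0) ∧
    (Submodule.span ℝ (Set.range e)).topologicalClosure = ⊤

end OrnsteinUhlenbeck

end

open OrnsteinUhlenbeck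

noncomputable section

namespace OrnsteinUhlenbeck

/-! The weight is a product of one-dimensional weights, `e^{-x²/4}` in each `x_i` and `|y|^a
e^{-y²/4}` in `y`, so products of one-dimensional eigenfunctions are eigenfunctions. More is true:
for such a product `e`, every single partial derivative satisfies a weak equation of its own, `∫ ∂_k
e ∂_k η dμ = λ_k ∫ e η dμ` (`IsMode`). The vector `(λ_k)` distinguishes any two indices even when
the eigenvalues `Σ λ_k` coincide, so testing two modes against each other in a direction where the
vectors differ gives orthogonality. A mode is also orthogonal to every weak eigenfunction for
another eigenvalue. Hence, once the modes are nonzero and total in `L²`, the eigenvalues, the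
eigenspaces and the basis property follow by Hilbert space algebra, without compact embeddings or
regularity theory (`eigenvalues_eq_of_isMode`, `weakEigenspace_eq_span_of_isMode`,
`isOrthogonalBasis_of_isMode`).

The weak equations come from integration by parts along lines parallel to the axes
(`integral_prodFun_mul_deriv`, `isMode_prodFun`). All that matters at `y = 0` is the flux `w u'`.
For the even profiles `L(y²/4)` it vanishes there, which is the Neumann condition. For the odd
profiles `y|y|^{-a} L(y²/4)` it is smooth on the whole line but need not vanish at `0`; on the
half-space this is harmless because Dirichlet test functions vanish near the boundary.

Membership in the Sobolev space is shown by truncation. Smooth modes need only a cutoff at infinity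
(`mem_sobolev_of_contDiff`). The odd ones also need a cutoff near `{y = 0}`, whose gradient is at
most `K/|y|`; since `a < 1`, `V/y` is in `L²` and dominated convergence applies
(`mem_sobolev_of_contDiffAt`).

For totality, let `f` be orthogonal to all modes of one type and let `H` be `f` times the weight,
and also times `y|y|^{-a}` for the odd type. Then `H` is integrable against every `e^{c|X|}`, hence
determined by its moments (`ae_eq_zero_of_moments`). Orthogonality kills the moments even in `y`, so
`H` plus its reflection vanishes (`ae_add_flip_eq_zero`). On the half-space `H` lives on one side
only and is therefore zero. On the whole space the even modes kill the even part of `f` and the odd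
modes kill its odd part. -/

/-- A separated mode: a function `e` of the Sobolev space whose gradient is the sum of vector fields
`G k` in the coordinate directions, each of which satisfies a weak eigenvalue equation of its own,
with eigenvalue `lam k`. -/
def IsMode {N : ℕ} (μ : Measure (Space N)) (U : Set (Space N)) (e : Lp ℝ 2 μ)
    (lam : Fin (N + 1) → ℝ) : Prop :=
  ∃ G : Fin (N + 1) → Lp (Space N) 2 μ,
    (∀ k, ∀ᵐ X ∂μ, ∀ l, l ≠ k → G k X l = 0) ∧ (e, ∑ k, G k) ∈ sobolev μ U ∧
    ∀ k, ∀ q ∈ sobolev μ U, inner ℝ (G k) q.2 = lam k * inner ℝ e q.1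

/-! ### Spectral consequences of having a total family of separated modes. -/

section Modes

variable {N : ℕ} {μ : Measure (Space N)} {U : Set (Space N)}

lemma inner_eq_zero_of_directions {k l : Fin (N + 1)} (hkl : k ≠ l) {F G : Lp (Space N) 2 μ}
    (hF : ∀ᵐ X ∂μ, ∀ j, j ≠ k → F X j = 0) (hG : ∀ᵐ X ∂μ, ∀ j, j ≠ l → G X j = 0) :
    inner ℝ F G = 0 := by
  rw [L2.inner_def]
  refine integral_eq_zero_of_ae ?_
  filter_upwards [hF, hG] with X h1 h2
  rw [PiLp.inner_apply]
  refine Finset.sum_eq_zero fun j _ => ?_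
  by_cases hj : j = k
  · subst hj; rw [h2 j hkl]; simp
  · rw [h1 j hj]; simp

/-- Testing each equation in direction `k` with the other mode leaves only `⟨G k, G' k⟩`, since
fields in different directions are pointwise orthogonal. This number equals both `lam k ⟨e, e'⟩` and
`lam' k ⟨e, e'⟩`. Only the vectors have to differ, not their sums, so orthogonality inside a
degenerate eigenspace is included. -/
lemma IsMode.inner_eq_zero {e e' : Lp ℝ 2 μ} {lam lam' : Fin (N + 1) → ℝ}
    (h : IsMode μ U e lam) (h' : IsMode μ U e' lam') (hne : lam ≠ lam') : inner ℝ e e' = 0 := by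
  obtain ⟨G, hG, hS, hW⟩ := h
  obtain ⟨G', hG', hS', hW'⟩ := h'
  obtain ⟨k, hk⟩ := Function.ne_iff.mp hne
  have h1 := hW k _ hS'
  have h2 := hW' k _ hS
  simp only [inner_sum] at h1 h2
  rw [Finset.sum_eq_single k (fun l _ hl => inner_eq_zero_of_directions hl.symm (hG k) (hG' l))
    (by simp)] at h1
  rw [Finset.sum_eq_single k (fun l _ hl => inner_eq_zero_of_directions hl.symm (hG' k) (hG l))
    (by simp), real_inner_comm, real_inner_comm e e'] at h2
  have h3 : (lam k - lam' k) * inner ℝ e e' = 0 := by rw [sub_mul, ← h1, ← h2, sub_self]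
  exact (mul_eq_zero.mp h3).resolve_left (sub_ne_zero.mpr hk)

lemma IsMode.mem_weakEigenspace {e : Lp ℝ 2 μ} {lam : Fin (N + 1) → ℝ}
    (h : IsMode μ U e lam) : e ∈ weakEigenspace μ U (∑ k, lam k) := by
  obtain ⟨G, hG, hS, hW⟩ := h
  refine ⟨_, hS, fun q hq => ?_⟩
  rw [sum_inner, Finset.sum_mul]
  exact Finset.sum_congr rfl fun k _ => hW k q hq

lemma IsMode.inner_eq_zero_of_mem_weakEigenspace {e V : Lp ℝ 2 μ} {lam : Fin (N + 1) → ℝ} {κ : ℝ}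
    (h : IsMode μ U e lam) (hV : V ∈ weakEigenspace μ U κ) (hne : ∑ k, lam k ≠ κ) :
    inner ℝ e V = 0 := by
  obtain ⟨G, hS, hW⟩ := h.mem_weakEigenspace
  obtain ⟨K, hK, hV⟩ := hV
  have h1 := hW _ hK
  have h2 := hV _ hS
  simp only at h1 h2
  rw [real_inner_comm, real_inner_comm e V] at h2
  have h3 : (∑ k, lam k - κ) * inner ℝ e V = 0 := by rw [sub_mul, ← h1, ← h2, sub_self]
  exact (mul_eq_zero.mp h3).resolve_left (sub_ne_zero.mpr hne)

variable {ι : Type*} {e : ι → Lp ℝ 2 μ} {lam : ι → Fin (N + 1) → ℝ}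

theorem isOrthogonalBasis_of_isMode (he : ∀ i, IsMode μ U (e i) (lam i))
    (hlam : Function.Injective lam) (h0 : ∀ i, e i ≠ 0)
    (hd : ∀ f : Lp ℝ 2 μ, (∀ i, inner ℝ (e i) f = 0) → f = 0) : IsOrthogonalBasis e := by
  refine ⟨h0, fun i j hij => (he i).inner_eq_zero (he j) (hlam.ne hij), ?_⟩
  rw [Submodule.topologicalClosure_eq_top_iff, Submodule.eq_bot_iff]
  intro f hf
  exact hd f fun i => (Submodule.mem_orthogonal _ _).mp hf _ (Submodule.subset_span ⟨i, rfl⟩)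

/-- Subtracting from an eigenfunction its projection onto the span leaves an eigenfunction for the
same `κ`. It is orthogonal to the modes with sum `κ` by construction and to all the others by
symmetry of the form, so totality makes it zero. Finiteness of the index set provides the
projection. -/
theorem weakEigenspace_eq_span_of_isMode (he : ∀ i, IsMode μ U (e i) (lam i))
    (hd : ∀ f : Lp ℝ 2 μ, (∀ i, inner ℝ (e i) f = 0) → f = 0) {κ : ℝ}
    (hfin : {i | ∑ k, lam i k = κ}.Finite) :
    weakEigenspace μ U κ = Submodule.span ℝ (e '' {i | ∑ k, lam i k = κ}) := by
  have hle : Submodule.span ℝ (e '' {i | ∑ k, lam i k = κ}) ≤ weakEigenspace μ U κ := by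
    rw [Submodule.span_le]
    rintro _ ⟨i, hi, rfl⟩
    exact hi ▸ (he i).mem_weakEigenspace
  refine le_antisymm (fun V hV => ?_) hle
  set F := Submodule.span ℝ (e '' {i | ∑ k, lam i k = κ}) with hF
  have : FiniteDimensional ℝ F := FiniteDimensional.span_of_finite ℝ (hfin.image e)
  have h1 : F.starProjection V ∈ F := Submodule.starProjection_apply_mem _ _
  have h2 : V - F.starProjection V ∈ Fᗮ := Submodule.sub_starProjection_mem_orthogonal V
  have h3 : V - F.starProjection V = 0 := by
    refine hd _ fun i => ?_
    by_cases hi : ∑ k, lam i k = κ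
    · exact (Submodule.mem_orthogonal _ _).mp h2 _ (Submodule.subset_span ⟨i, hi, rfl⟩)
    · exact (he i).inner_eq_zero_of_mem_weakEigenspace (sub_mem hV (hle h1)) hi
  rw [sub_eq_zero.mp h3]
  exact h1

theorem eigenvalues_eq_of_isMode (he : ∀ i, IsMode μ U (e i) (lam i)) (h0 : ∀ i, e i ≠ 0)
    (hd : ∀ f : Lp ℝ 2 μ, (∀ i, inner ℝ (e i) f = 0) → f = 0) :
    eigenvalues μ U = {κ | ∃ i, κ = ∑ k, lam i k} := by
  ext κ
  constructor
  · rintro ⟨V, hV, hV0⟩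
    by_contra hκ
    refine hV0 (hd V fun i => (he i).inner_eq_zero_of_mem_weakEigenspace hV fun h => hκ ⟨i, h.symm⟩)
  · rintro ⟨i, rfl⟩
    exact ⟨_, (he i).mem_weakEigenspace, h0 i⟩

theorem finiteDimensional_weakEigenspace_of_isMode (he : ∀ i, IsMode μ U (e i) (lam i))
    (hd : ∀ f : Lp ℝ 2 μ, (∀ i, inner ℝ (e i) f = 0) → f = 0) {κ : ℝ}
    (hfin : {i | ∑ k, lam i k = κ}.Finite) : FiniteDimensional ℝ (weakEigenspace μ U κ) := by
  rw [weakEigenspace_eq_span_of_isMode he hd hfin]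
  exact FiniteDimensional.span_of_finite ℝ (hfin.image e)

end Modes

/-! ### Hermite and Laguerre polynomials and their differential equations. -/

open Polynomial in
/-- The Hermite polynomials for the weight `e^{-x²/4}`, as polynomials. -/
def hermitePoly : ℕ → ℝ[X]
  | 0 => 1
  | n + 1 => X * hermitePoly n - 2 * derivative (hermitePoly n)

open Polynomial in
lemma derivative_hermitePoly_succ (n : ℕ) :
    derivative (hermitePoly (n + 1)) = (n + 1 : ℝ[X]) * hermitePoly n := by
  induction n with
  | zero => simp [hermitePoly]
  | succ n ih =>
    rw [hermitePoly, derivative_sub, derivative_mul, derivative_mul, ih]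
    have h := congrArg derivative ih
    have h1 : derivative (derivative (hermitePoly (n + 1)))
        = (n + 1 : ℝ[X]) * derivative (hermitePoly n) := by
      rw [h, derivative_mul]; simp
    have h2 : derivative ((n + 1 : ℝ[X]) * hermitePoly n)
        = (n + 1 : ℝ[X]) * derivative (hermitePoly n) := by
      rw [derivative_mul]; simp
    have h3 : derivative (2 : ℝ[X]) = 0 := derivative_ofNat 2
    rw [h2, h3, derivative_X, hermitePoly]
    push_cast
    ring

-- Differentiating the defining recursion and inserting `H_{n+1}' = (n+1) H_n` gives the equation.
open Polynomial in
lemma hermitePoly_ode (n : ℕ) :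
    2 * derivative (derivative (hermitePoly n))
      = X * derivative (hermitePoly n) - (n : ℝ[X]) * hermitePoly n := by
  have h := derivative_hermitePoly_succ n
  have h3 : derivative (2 : ℝ[X]) = 0 := derivative_ofNat 2
  rw [hermitePoly, derivative_sub, derivative_mul, derivative_mul, h3, derivative_X] at h
  linear_combination -h

lemma hermitePoly_ne_zero (n : ℕ) : hermitePoly n ≠ 0 := by
  induction n with
  | zero => simp [hermitePoly]
  | succ n ih =>
    intro h
    have h1 := derivative_hermitePoly_succ n
    rw [h, Polynomial.derivative_zero] at h1
    have h2 : (n + 1 : Polynomial ℝ) ≠ 0 := by exact_mod_cast Nat.succ_ne_zero n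
    exact mul_ne_zero h2 ih h1.symm

lemma derivative_hermite_succ (n : ℕ) :
    Polynomial.derivative (Polynomial.hermite (n + 1)) = (n + 1) * Polynomial.hermite n := by
  induction n with
  | zero => simp
  | succ n ih =>
    have h2 : Polynomial.derivative ((n + 1 : Polynomial ℤ) * Polynomial.hermite n)
        = (n + 1 : Polynomial ℤ) * Polynomial.derivative (Polynomial.hermite n) := by
      rw [Polynomial.derivative_mul]; simp
    rw [Polynomial.hermite_succ (n + 1), Polynomial.derivative_sub, Polynomial.derivative_mul, ih,
      h2, Polynomial.derivative_X, Polynomial.hermite_succ n]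
    push_cast
    ring

/-- With the lowering identities for both families, each satisfies a three-term recurrence; the
factor `√2 ^ n` and the argument `x / √2` turn one recurrence into the other. -/
lemma hermite_eq_eval (n : ℕ) (x : ℝ) : hermite n x = (hermitePoly n).eval x := by
  have h2 : Real.sqrt 2 ^ 2 = 2 := Real.sq_sqrt (by norm_num)
  have h0 : Real.sqrt 2 ≠ 0 := by positivity
  induction n using Nat.twoStepInduction with
  | zero => simp [hermite, hermitePoly]
  | one => simp [hermite, hermitePoly, mul_div_cancel₀ x h0]
  | more n ih1 ih2 =>
    rw [hermitePoly, Polynomial.eval_sub, Polynomial.eval_mul, Polynomial.eval_mul,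
      derivative_hermitePoly_succ, Polynomial.eval_mul, ← ih1, ← ih2]
    simp only [hermite]
    rw [Polynomial.hermite_succ (n + 1), derivative_hermite_succ]
    have h3 : Real.sqrt 2 ^ (n + 2) = Real.sqrt 2 ^ n * 2 := by rw [pow_add, h2]
    have h4 : Real.sqrt 2 * (x / Real.sqrt 2) = x := by field_simp
    simp only [map_sub, map_mul, Polynomial.aeval_X, map_add, map_natCast, map_one,
      Polynomial.eval_X, Polynomial.eval_add, Polynomial.eval_natCast, Polynomial.eval_one,
      Polynomial.eval_ofNat]
    set A := (Polynomial.aeval (x / Real.sqrt 2)) (Polynomial.hermite n)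
    set B := (Polynomial.aeval (x / Real.sqrt 2)) (Polynomial.hermite (n + 1))
    have h5 : Real.sqrt 2 ^ (n + 1 + 1) * (x / Real.sqrt 2) = Real.sqrt 2 ^ (n + 1) * x := by
      rw [pow_succ, mul_assoc, h4]
    linear_combination B * h5 - A * (n + 1) * h3

open Polynomial in
lemma X_mul_hermitePoly (n : ℕ) :
    X * hermitePoly n = hermitePoly (n + 1) + (2 * n : ℝ[X]) * hermitePoly (n - 1) := by
  cases n with
  | zero => simp [hermitePoly]
  | succ n =>
    rw [hermitePoly.eq_2 (n + 1), derivative_hermitePoly_succ, Nat.add_sub_cancel]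
    push_cast
    ring

/-- The coefficients of the Laguerre polynomials. -/
def laguerreCoeff (s : ℝ) (m j : ℕ) : ℝ :=
  (-1) ^ j * ((∏ i ∈ Finset.Ioc j m, (s + (i : ℝ))) / (Nat.factorial (m - j) : ℝ)) *
    (1 / (Nat.factorial j : ℝ))

/-- The Laguerre polynomials, as polynomials. -/
def laguerrePoly (s : ℝ) (m : ℕ) : Polynomial ℝ :=
  ∑ j ∈ Finset.range (m + 1), Polynomial.monomial j (laguerreCoeff s m j)

lemma laguerre_eq_eval (s : ℝ) (m : ℕ) (r : ℝ) : laguerre s m r = (laguerrePoly s m).eval r := by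
  simp only [laguerre, laguerrePoly, laguerreCoeff, Polynomial.eval_finsetSum,
    Polynomial.eval_monomial]
  exact Finset.sum_congr rfl fun j _ => by ring

lemma coeff_laguerrePoly (s : ℝ) (m j : ℕ) :
    (laguerrePoly s m).coeff j = if j ≤ m then laguerreCoeff s m j else 0 := by
  simp [laguerrePoly, Polynomial.finsetSum_coeff, Polynomial.coeff_monomial]

lemma degree_laguerrePoly (s : ℝ) (m : ℕ) : (laguerrePoly s m).degree = m := by
  refine le_antisymm (Polynomial.degree_le_iff_coeff_zero _ _ |>.mpr fun j hj => ?_)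
    (Polynomial.le_degree_of_ne_zero ?_)
  · rw [coeff_laguerrePoly, if_neg (by exact_mod_cast hj.not_ge)]
  · rw [coeff_laguerrePoly, if_pos le_rfl]
    simp [laguerreCoeff, Nat.factorial_ne_zero]

/-- Passing from `j` to `j + 1` removes the factor `s + j + 1` from the product. Writing the
recursion with this factor on the left avoids any division, so no condition on `s` is needed. -/
lemma laguerreCoeff_succ (s : ℝ) {m j : ℕ} (hj : j < m) :
    ((j : ℝ) + 1) * (j + s + 1) * laguerreCoeff s m (j + 1) = -((m : ℝ) - j) * laguerreCoeff s m j := by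
  obtain ⟨k, rfl⟩ : ∃ k, m = j + 1 + k := ⟨m - (j + 1), by omega⟩
  have h1 : Finset.Ioc j (j + 1 + k) = insert (j + 1) (Finset.Ioc (j + 1) (j + 1 + k)) := by
    ext i; simp only [Finset.mem_Ioc, Finset.mem_insert]; omega
  have h2 : j + 1 + k - j = k + 1 := by omega
  have h3 : j + 1 + k - (j + 1) = k := by omega
  simp only [laguerreCoeff]
  rw [h1, Finset.prod_insert (by simp), h2, h3, Nat.factorial_succ, Nat.factorial_succ]
  have := Nat.factorial_ne_zero k
  have := Nat.factorial_ne_zero j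
  push_cast
  field_simp
  ring

-- Compared coefficient by coefficient, the equation is the two-term recursion of the coefficients;
-- at `j = m` it holds because the factor `m - j` vanishes.
open Polynomial in
lemma laguerrePoly_ode (s : ℝ) (m : ℕ) :
    X * derivative (derivative (laguerrePoly s m)) + (C (s + 1) - X) * derivative (laguerrePoly s m)
      = -(C (m : ℝ) * laguerrePoly s m) := by
  have key : ∀ j : ℕ, ((j : ℝ) + 1) * (j + s + 1) * (laguerrePoly s m).coeff (j + 1)
      = -((m : ℝ) - j) * (laguerrePoly s m).coeff j := by
    intro j
    simp only [coeff_laguerrePoly]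
    rcases lt_trichotomy j m with h | h | h
    · rw [if_pos (by omega), if_pos (by omega), laguerreCoeff_succ s h]
    · subst h; simp
    · rw [if_neg (by omega), if_neg (by omega)]; simp
  ext j
  rw [sub_mul]
  cases j with
  | zero =>
    have h := key 0
    simp only [coeff_add, coeff_sub, mul_coeff_zero, coeff_X_zero, coeff_C_zero, coeff_derivative,
      coeff_neg] at h ⊢
    push_cast at h ⊢
    linear_combination h
  | succ j =>
    have h := key (j + 1)
    simp only [coeff_add, coeff_sub, coeff_X_mul, coeff_C_mul, coeff_derivative,
      coeff_neg] at h ⊢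
    push_cast at h ⊢
    linear_combination h

/-! ### Integrability against a Gaussian weight -/

lemma exists_abs_eval_le_exp (P : Polynomial ℝ) :
    ∃ C, ∀ x, |P.eval x| ≤ C * Real.exp |x| := by
  induction P using Polynomial.induction_on' with
  | add p q hp hq =>
    obtain ⟨C, hC⟩ := hp
    obtain ⟨D, hD⟩ := hq
    refine ⟨C + D, fun x => ?_⟩
    rw [Polynomial.eval_add, add_mul]
    exact (abs_add_le _ _).trans (add_le_add (hC x) (hD x))
  | monomial n c =>
    refine ⟨|c| * n.factorial, fun x => ?_⟩
    have h := Real.pow_div_factorial_le_exp |x| (abs_nonneg x) n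
    rw [div_le_iff₀ (by positivity)] at h
    rw [Polynomial.eval_monomial, abs_mul, abs_pow, mul_assoc]
    gcongr
    linarith

lemma integrable_abs_rpow_mul_exp {b β : ℝ} (hb : -1 < b) (hβ : 0 < β) :
    Integrable fun x : ℝ => |x| ^ b * Real.exp (-β * x ^ 2) := by
  have h := (integrable_rpow_mul_exp_neg_mul_sq hβ hb).integrableOn (s := Set.Ioi 0)
  have h1 : IntegrableOn (fun x : ℝ => |x| ^ b * Real.exp (-β * |x| ^ 2)) (Set.Ioi 0) := by
    refine h.congr_fun (fun x hx => ?_) measurableSet_Ioi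
    simp only [abs_of_pos (Set.mem_Ioi.mp hx)]
  have h2 : IntegrableOn (fun x : ℝ => |x| ^ b * Real.exp (-β * |x| ^ 2)) (Set.Iic 0) := by
    rw [integrableOn_Iic_iff_integrableOn_Iio]
    have h3 := ((Measure.measurePreserving_neg (volume : Measure ℝ)).integrableOn_comp_preimage
      (Homeomorph.neg ℝ).measurableEmbedding).mpr h1
    simpa [Function.comp_def] using h3
  have h4 := h2.union h1
  rw [Set.Iic_union_Ioi, integrableOn_univ] at h4
  simpa using h4

lemma integrable_abs_rpow_mul_of_le_exp {b : ℝ} (hb : -1 < b) {g : ℝ → ℝ} (hg : Measurable g)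
    {C c : ℝ} (hC : ∀ x, |g x| ≤ C * Real.exp (c * |x|)) :
    Integrable fun x : ℝ => |x| ^ b * g x * Real.exp (-x ^ 2 / 4) := by
  have hC0 : 0 ≤ C := by
    have := (abs_nonneg _).trans (hC 0)
    simpa using this
  refine Integrable.mono' ((integrable_abs_rpow_mul_exp hb (β := 1 / 8) (by norm_num)).const_mul
    (C * Real.exp (2 * c ^ 2))) ?_ (Filter.Eventually.of_forall fun x => ?_)
  · exact Measurable.aestronglyMeasurable (by fun_prop)
  · rw [Real.norm_eq_abs, abs_mul, abs_mul, Real.abs_exp, abs_of_nonneg (by positivity : 0 ≤ |x| ^ b)]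
    -- Half of the Gaussian absorbs the exponential: `x²/8 - c|x| + 2c² = (|x| - 4c)²/8 ≥ 0`.
    have h1 : Real.exp (c * |x|) * Real.exp (-x ^ 2 / 4)
        ≤ Real.exp (2 * c ^ 2) * Real.exp (-(1 / 8) * x ^ 2) := by
      rw [← Real.exp_add, ← Real.exp_add, Real.exp_le_exp]
      have := sq_abs x
      nlinarith [sq_nonneg (|x| / 4 - c), sq_nonneg (|x| - 4 * c)]
    calc |x| ^ b * |g x| * Real.exp (-x ^ 2 / 4)
        ≤ |x| ^ b * (C * Real.exp (c * |x|)) * Real.exp (-x ^ 2 / 4) := by gcongr; exact hC x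
      _ = |x| ^ b * C * (Real.exp (c * |x|) * Real.exp (-x ^ 2 / 4)) := by ring
      _ ≤ |x| ^ b * C * (Real.exp (2 * c ^ 2) * Real.exp (-(1 / 8) * x ^ 2)) := by gcongr
      _ = _ := by ring

/-- The indicator function of a set of reals. -/
def chi (A : Set ℝ) (x : ℝ) : ℝ := A.indicator 1 x

/-- The sets of reals over which the last coordinate ranges: everything, or a half-line. -/
def IsRange (A : Set ℝ) : Prop := A = Set.univ ∨ A = Set.Ioi 0

lemma chi_nonneg (A : Set ℝ) (x : ℝ) : 0 ≤ chi A x :=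
  Set.indicator_nonneg (fun _ _ => zero_le_one) x

lemma chi_le_one (A : Set ℝ) (x : ℝ) : chi A x ≤ 1 := by
  by_cases h : x ∈ A <;> simp [chi, h]

lemma chi_mul_self (A : Set ℝ) (x : ℝ) : chi A x * chi A x = chi A x := by
  by_cases h : x ∈ A <;> simp [chi, h]

lemma chi_of_mem {A : Set ℝ} {x : ℝ} (h : x ∈ A) : chi A x = 1 := by simp [chi, h]

lemma chi_of_notMem {A : Set ℝ} {x : ℝ} (h : x ∉ A) : chi A x = 0 := by simp [chi, h]

lemma IsRange.measurableSet {A : Set ℝ} (hA : IsRange A) : MeasurableSet A := by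
  rcases hA with rfl | rfl
  exacts [MeasurableSet.univ, measurableSet_Ioi]

lemma IsRange.measurable_chi {A : Set ℝ} (hA : IsRange A) : Measurable (chi A) :=
  measurable_const.indicator hA.measurableSet

lemma IsRange.eventually_chi_eq {A : Set ℝ} (hA : IsRange A) {x : ℝ} (hx : x ≠ 0) :
    ∀ᶠ t in nhds x, chi A t = chi A x := by
  rcases hA with rfl | rfl
  · simp [chi]
  · rcases lt_or_gt_of_ne hx with h | h
    · filter_upwards [Iio_mem_nhds h] with t ht
      rw [chi_of_notMem (by simpa using le_of_lt (Set.mem_Iio.mp ht)),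
        chi_of_notMem (by simpa using h.le)]
    · filter_upwards [Ioi_mem_nhds h] with t ht
      rw [chi_of_mem (Set.mem_Ioi.mpr h), chi_of_mem ht]

/-- The factor `e^{c|x|}` is carried along for the sake of the moment argument; the case `c = 0`
gives the norms of the modes. -/
lemma integrable_chi_mul {A : Set ℝ} (hA : IsRange A) {b : ℝ} (hb : -1 < b) (P : Polynomial ℝ)
    (c : ℝ) :
    Integrable fun x : ℝ =>
      chi A x * (|x| ^ b * (P.eval x * Real.exp (c * |x|)) * Real.exp (-x ^ 2 / 4)) := by
  obtain ⟨C, hC⟩ := exists_abs_eval_le_exp P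
  have h := integrable_abs_rpow_mul_of_le_exp hb
    (g := fun x => chi A x * (P.eval x * Real.exp (c * |x|))) (C := C) (c := 1 + c)
    (by have := hA.measurable_chi; have := P.continuous.measurable; fun_prop) fun x => by
      rw [abs_mul, abs_mul, Real.abs_exp, abs_of_nonneg (chi_nonneg A x), add_mul, Real.exp_add,
        one_mul, ← mul_assoc C]
      calc chi A x * (|P.eval x| * Real.exp (c * |x|))
          ≤ 1 * (|P.eval x| * Real.exp (c * |x|)) := by gcongr; exact chi_le_one A x
        _ ≤ C * Real.exp |x| * Real.exp (c * |x|) := by rw [one_mul]; gcongr; exact hC x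
  refine h.congr (Filter.Eventually.of_forall fun x => ?_)
  ring

lemma integrable_chi_mul_poly {A : Set ℝ} (hA : IsRange A) {b : ℝ} (hb : -1 < b)
    (P : Polynomial ℝ) :
    Integrable fun x : ℝ => chi A x * (|x| ^ b * P.eval x * Real.exp (-x ^ 2 / 4)) := by
  simpa using integrable_chi_mul hA hb P 0

/-! ### One-dimensional eigenfunctions and their fluxes. -/

/-- A one-dimensional eigenfunction `u` for the weight `w`, with derivative `d`, flux `f = w u'` and
eigenvalue `lam`: away from the origin `f' = -lam w u`. -/
structure Factor (w u d f : ℝ → ℝ) (lam : ℝ) : Prop where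
  measurable_u : Measurable u
  measurable_d : Measurable d
  integrable_sq : Integrable fun x => u x ^ 2 * w x
  integrable_deriv_sq : Integrable fun x => d x ^ 2 * w x
  integrable_mul : Integrable fun x => u x * w x
  integrable_flux : Integrable f
  flux_eq : ∀ x ≠ 0, f x = d x * w x
  hasDerivAt : ∀ x ≠ 0, HasDerivAt u (d x) x
  hasDerivAt_flux : ∀ x ≠ 0, HasDerivAt f (-(lam * (u x * w x))) x

lemma ae_ne_zero : ∀ᵐ x : ℝ, x ≠ 0 := Measure.ae_ne volume 0

/-- The weight `e^{-x²/4}`. -/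
def gaussWeight (x : ℝ) : ℝ := Real.exp (-x ^ 2 / 4)

/-- The weight `|y|^a e^{-y²/4}` on the set `A`. -/
def lastWeight (A : Set ℝ) (a : ℝ) (y : ℝ) : ℝ := chi A y * (|y| ^ a * gaussWeight y)

lemma hasDerivAt_gaussWeight (x : ℝ) : HasDerivAt gaussWeight (-(x / 2) * gaussWeight x) x := by
  have h : HasDerivAt (fun x : ℝ => -x ^ 2 / 4) (-(x / 2)) x := by
    exact ((hasDerivAt_pow 2 x).neg.div_const 4).congr_deriv (by push_cast; ring)
  have := h.exp
  rwa [mul_comm] at this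

lemma continuous_gaussWeight : Continuous gaussWeight := by
  unfold gaussWeight; fun_prop

lemma gaussWeight_pos (x : ℝ) : 0 < gaussWeight x := Real.exp_pos _

lemma lastWeight_nonneg (A : Set ℝ) (a y : ℝ) : 0 ≤ lastWeight A a y :=
  mul_nonneg (chi_nonneg A y) (mul_nonneg (by positivity) (gaussWeight_pos y).le)

lemma integrable_poly_mul_gaussWeight (P : Polynomial ℝ) :
    Integrable fun x => P.eval x * gaussWeight x := by
  have h := integrable_chi_mul_poly (A := Set.univ) (Or.inl rfl) (b := 0) (by norm_num) P
  simpa [chi, gaussWeight] using h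

/-- Since `g' = -(x/2) g` for the Gaussian `g`, `(H' g)' = (H'' - (x/2) H') g`, and the Hermite
equation makes this `-(n/2) H g`. -/
theorem factor_hermite (n : ℕ) :
    Factor gaussWeight (hermite n) (fun x => (hermitePoly n).derivative.eval x)
      (fun x => (hermitePoly n).derivative.eval x * gaussWeight x) ((n : ℝ) / 2) := by
  have hu : hermite n = fun x => (hermitePoly n).eval x := funext (hermite_eq_eval n)
  rw [hu]
  refine ⟨(hermitePoly n).continuous.measurable, (Polynomial.continuous _).measurable, ?_, ?_,
    integrable_poly_mul_gaussWeight _, integrable_poly_mul_gaussWeight _, fun _ _ => rfl,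
    fun x _ => (hermitePoly n).hasDerivAt x, fun x _ => ?_⟩
  · exact (integrable_poly_mul_gaussWeight (hermitePoly n ^ 2)).congr
      (Filter.Eventually.of_forall fun x => by simp only [Polynomial.eval_pow])
  · exact (integrable_poly_mul_gaussWeight ((hermitePoly n).derivative ^ 2)).congr
      (Filter.Eventually.of_forall fun x => by simp only [Polynomial.eval_pow])
  · refine (((hermitePoly n).derivative.hasDerivAt x).mul (hasDerivAt_gaussWeight x)).congr_deriv ?_
    have h := congrArg (Polynomial.eval x) (hermitePoly_ode n)
    simp only [Polynomial.eval_mul, Polynomial.eval_sub, Polynomial.eval_X,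
      Polynomial.eval_natCast, Polynomial.eval_ofNat] at h
    linear_combination (gaussWeight x / 2) * h

lemma hasDerivAt_abs_rpow_mul_self (b : ℝ) {x : ℝ} (hx : x ≠ 0) :
    HasDerivAt (fun x : ℝ => |x| ^ b * x) ((b + 1) * |x| ^ b) x := by
  have h1 := (hasDerivAt_abs hx).rpow_const (p := b) (Or.inl (abs_ne_zero.mpr hx))
  refine (h1.mul (hasDerivAt_id x)).congr_deriv ?_
  have h2 : |x| ^ (b - 1) * |x| = |x| ^ b := by
    rw [Real.rpow_sub_one (abs_ne_zero.mpr hx), div_mul_cancel₀ _ (abs_ne_zero.mpr hx)]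
  have h3 : (SignType.sign x : ℝ) * x = |x| := sign_mul_self x
  simp only [id]
  linear_combination b * h2 + b * |x| ^ (b - 1) * h3

lemma continuous_abs_rpow_mul_self {b : ℝ} (hb : -1 < b) :
    Continuous fun x : ℝ => |x| ^ b * x := by
  rw [continuous_iff_continuousAt]
  intro x
  by_cases hx : x = 0
  · subst hx
    rw [ContinuousAt, mul_zero, tendsto_zero_iff_norm_tendsto_zero]
    have h1 : (fun x : ℝ => ‖|x| ^ b * x‖) = fun x => |x| ^ (b + 1) := by
      funext x
      rw [norm_mul, Real.norm_eq_abs, Real.norm_eq_abs, abs_of_nonneg (by positivity)]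
      by_cases hx : x = 0
      · subst hx; simp [Real.zero_rpow (by linarith : b + 1 ≠ 0)]
      · rw [Real.rpow_add_one (abs_ne_zero.mpr hx)]
    rw [h1]
    have h2 : Continuous fun x : ℝ => |x| ^ (b + 1) :=
      continuous_abs.rpow_const fun _ => Or.inr (by linarith)
    simpa [Real.zero_rpow (by linarith : b + 1 ≠ 0)] using h2.tendsto 0
  · exact (hasDerivAt_abs_rpow_mul_self b hx).continuousAt

/-- The polynomial `y ↦ P(y²/4)`. -/
def quarterSq (P : Polynomial ℝ) : Polynomial ℝ := P.comp (Polynomial.C (1 / 4) * Polynomial.X ^ 2)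

lemma eval_quarterSq (P : Polynomial ℝ) (y : ℝ) : (quarterSq P).eval y = P.eval (y ^ 2 / 4) := by
  rw [quarterSq, Polynomial.eval_comp]
  congr 1
  simp; ring

lemma hasDerivAt_eval_sq (P : Polynomial ℝ) (y : ℝ) :
    HasDerivAt (fun y => P.eval (y ^ 2 / 4)) (y / 2 * P.derivative.eval (y ^ 2 / 4)) y := by
  have h : HasDerivAt (fun y : ℝ => y ^ 2 / 4) (y / 2) y := by
    exact ((hasDerivAt_pow 2 y).div_const 4).congr_deriv (by push_cast; ring)
  have := (P.hasDerivAt (y ^ 2 / 4)).comp y h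
  rwa [mul_comm] at this

lemma integrable_lastWeight_mul {A : Set ℝ} (hA : IsRange A) {b : ℝ} (hb : -1 < b)
    (P : Polynomial ℝ) : Integrable fun y => P.eval y * lastWeight A b y := by
  refine (integrable_chi_mul_poly hA hb P).congr (Filter.Eventually.of_forall fun y => ?_)
  simp only [lastWeight, gaussWeight]
  ring

/-- The substitution `r = y²/4` turns the equation in `y` into Laguerre's equation of order
`(a-1)/2`. The flux is written as `|y|^a y` times a smooth function, which displays its continuity
and its vanishing at `0` when `a > -1`. -/
theorem factor_even {A : Set ℝ} (hA : IsRange A) {a : ℝ} (ha : -1 < a) (m : ℕ) :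
    Factor (lastWeight A a) (fun y => laguerre ((a - 1) / 2) m (y ^ 2 / 4))
      (fun y => y / 2 * (laguerrePoly ((a - 1) / 2) m).derivative.eval (y ^ 2 / 4))
      (fun y => chi A y * ((|y| ^ a * y) *
        ((1 / 2) * ((laguerrePoly ((a - 1) / 2) m).derivative.eval (y ^ 2 / 4) * gaussWeight y))))
      m := by
  simp only [laguerre_eq_eval]
  set L := laguerrePoly ((a - 1) / 2) m with hL
  refine ⟨by fun_prop, by fun_prop, ?_, ?_, ?_, ?_, fun y _ => ?_,
    fun y _ => hasDerivAt_eval_sq L y, fun y hy => ?_⟩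
  · exact (integrable_lastWeight_mul hA ha (quarterSq L ^ 2)).congr
      (Filter.Eventually.of_forall fun y => by simp only [Polynomial.eval_pow, eval_quarterSq])
  · refine (integrable_lastWeight_mul hA ha
      (Polynomial.X ^ 2 * Polynomial.C (1 / 4) * quarterSq L.derivative ^ 2)).congr
      (Filter.Eventually.of_forall fun y => ?_)
    simp only [Polynomial.eval_mul, Polynomial.eval_pow, Polynomial.eval_X, Polynomial.eval_C,
      eval_quarterSq]
    ring
  · simpa [eval_quarterSq] using integrable_lastWeight_mul hA ha (quarterSq L)
  · refine (integrable_lastWeight_mul hA ha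
      (Polynomial.X * Polynomial.C (1 / 2) * quarterSq L.derivative)).congr
      (Filter.Eventually.of_forall fun y => ?_)
    simp only [Polynomial.eval_mul, Polynomial.eval_X, Polynomial.eval_C,
      eval_quarterSq, lastWeight]
    ring
  · simp only [lastWeight]
    ring
  · have h1 := (hasDerivAt_abs_rpow_mul_self a hy).mul
      (((hasDerivAt_eval_sq L.derivative y).mul (hasDerivAt_gaussWeight y)).const_mul (1 / 2))
    have h2 := h1.const_mul (chi A y)
    have h3 : HasDerivAt (fun y => chi A y * ((|y| ^ a * y) *
        ((1 / 2) * (L.derivative.eval (y ^ 2 / 4) * gaussWeight y)))) _ y :=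
      h2.congr_of_eventuallyEq ((hA.eventually_chi_eq hy).mono fun t ht => by simp [ht])
    refine h3.congr_deriv ?_
    have h := congrArg (Polynomial.eval (y ^ 2 / 4)) (laguerrePoly_ode ((a - 1) / 2) m)
    simp only [← hL, Polynomial.eval_mul, Polynomial.eval_sub, Polynomial.eval_X,
      Polynomial.eval_add, Polynomial.eval_C, Polynomial.eval_neg] at h
    simp only [lastWeight, Pi.mul_apply]
    linear_combination (chi A y * |y| ^ a * gaussWeight y) * h

lemma continuous_flux_even {a : ℝ} (ha : -1 < a) (P : Polynomial ℝ) :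
    Continuous (fun y => (|y| ^ a * y) * ((1 / 2) * (P.eval (y ^ 2 / 4) * gaussWeight y))) := by
  have := continuous_abs_rpow_mul_self ha
  have := continuous_gaussWeight
  fun_prop

/-- This is where the Neumann condition enters: a flux that vanishes at `0` remains continuous when
cut off to the half-line, so test functions need not vanish on the boundary. -/
lemma continuous_chi_mul {A : Set ℝ} (hA : IsRange A) {f : ℝ → ℝ} (hf : Continuous f)
    (h0 : f 0 = 0) : Continuous fun y => chi A y * f y := by
  rcases hA with rfl | rfl
  · simpa [chi] using hf
  · have : (fun y => chi (Set.Ioi 0) y * f y) = fun y => if y ≤ 0 then 0 else f y := by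
      funext y
      by_cases h : y ≤ 0
      · rw [if_pos h, chi_of_notMem (by simpa using h), zero_mul]
      · rw [if_neg h, chi_of_mem (by simpa using h), one_mul]
    rw [this]
    exact Continuous.if_le continuous_const hf continuous_id continuous_const
      fun y hy => by rw [hy, h0]

lemma abs_rpow_neg_mul {a y : ℝ} (hy : y ≠ 0) : |y| ^ (-a) * |y| ^ a = 1 := by
  rw [← Real.rpow_add (abs_pos.mpr hy), neg_add_cancel, Real.rpow_zero]

/-- The derivative of `y|y|^{-a} L(y²/4)` is `|y|^{-a}` times a polynomial `Q`, and the weight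
`|y|^a` cancels the singular power. The flux is thus `Q` times the Gaussian, smooth up to the cutoff
`chi A`, and Laguerre's equation of order `(1-a)/2` gives its derivative. Integrability of the
squares rests on that of `|y|^{-a}`, that is, on `a < 1`. -/
theorem factor_odd {A : Set ℝ} (hA : IsRange A) {a : ℝ} (ha : a < 1) (m : ℕ) :
    Factor (lastWeight A a)
      (fun y => chi A y * ((y * |y| ^ (-a)) * laguerre ((1 - a) / 2) m (y ^ 2 / 4)))
      (fun y => chi A y * (|y| ^ (-a) * ((1 - a) * (laguerrePoly ((1 - a) / 2) m).eval (y ^ 2 / 4)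
        + y ^ 2 / 2 * (laguerrePoly ((1 - a) / 2) m).derivative.eval (y ^ 2 / 4))))
      (fun y => chi A y * (((1 - a) * (laguerrePoly ((1 - a) / 2) m).eval (y ^ 2 / 4)
        + y ^ 2 / 2 * (laguerrePoly ((1 - a) / 2) m).derivative.eval (y ^ 2 / 4)) * gaussWeight y))
      (m + (1 - a) / 2) := by
  simp only [laguerre_eq_eval]
  set L := laguerrePoly ((1 - a) / 2) m with hL
  have hχ := hA.measurable_chi
  have hsq : ∀ y, chi A y ^ 2 = chi A y := fun y => by rw [sq, chi_mul_self]
  set Q : Polynomial ℝ := Polynomial.C (1 - a) * quarterSq L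
    + Polynomial.X ^ 2 * Polynomial.C (1 / 2) * quarterSq L.derivative with hQ
  have hQe : ∀ y, Q.eval y = (1 - a) * L.eval (y ^ 2 / 4)
      + y ^ 2 / 2 * L.derivative.eval (y ^ 2 / 4) := fun y => by
    simp only [hQ, Polynomial.eval_add, Polynomial.eval_mul, Polynomial.eval_pow, Polynomial.eval_X,
      Polynomial.eval_C, eval_quarterSq]
    ring
  have hLc : Continuous fun y : ℝ => L.eval (y ^ 2 / 4) := by fun_prop
  have hQc : Continuous fun y : ℝ => Q.eval y := by fun_prop
  simp only [← hQe]
  refine ⟨by fun_prop, by fun_prop, ?_, ?_, ?_, ?_, fun y hy => ?_, fun y hy => ?_, fun y hy => ?_⟩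
  · refine (integrable_lastWeight_mul hA (b := -a) (by linarith)
      (Polynomial.X ^ 2 * quarterSq L ^ 2)).congr (ae_ne_zero.mono fun y hy => ?_)
    have h := abs_rpow_neg_mul (a := a) hy
    simp only [Polynomial.eval_mul, Polynomial.eval_pow, Polynomial.eval_X, eval_quarterSq,
      lastWeight]
    rw [mul_pow, hsq]
    linear_combination (- (chi A y * chi A y) * y ^ 2 * |y| ^ (-a) * L.eval (y ^ 2 / 4) ^ 2
      * gaussWeight y) * h - (y ^ 2 * L.eval (y ^ 2 / 4) ^ 2 * |y| ^ (-a) * gaussWeight y) * hsq y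
  · refine (integrable_lastWeight_mul hA (b := -a) (by linarith)
      (Q ^ 2)).congr (ae_ne_zero.mono fun y hy => ?_)
    have h := abs_rpow_neg_mul (a := a) hy
    simp only [Polynomial.eval_pow, lastWeight]
    rw [mul_pow, hsq]
    linear_combination (- (chi A y * chi A y) * |y| ^ (-a) * Q.eval y ^ 2
      * gaussWeight y) * h - (Q.eval y ^ 2 * |y| ^ (-a) * gaussWeight y) * hsq y
  · refine (integrable_lastWeight_mul hA (b := 0) (by norm_num)
      (Polynomial.X * quarterSq L)).congr (ae_ne_zero.mono fun y hy => ?_)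
    have h := abs_rpow_neg_mul (a := a) hy
    simp only [Polynomial.eval_mul, Polynomial.eval_X, eval_quarterSq,
      lastWeight, Real.rpow_zero]
    linear_combination (- (chi A y * chi A y) * y * L.eval (y ^ 2 / 4)
      * gaussWeight y) * h - (y * L.eval (y ^ 2 / 4) * gaussWeight y) * hsq y
  · refine (integrable_lastWeight_mul hA (b := 0) (by norm_num) Q).congr
      (Filter.Eventually.of_forall fun y => ?_)
    simp only [lastWeight, Real.rpow_zero]
    ring
  · have h := abs_rpow_neg_mul (a := a) hy
    simp only [lastWeight]
    linear_combination (- (chi A y * chi A y) * Q.eval y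
      * gaussWeight y) * h - (Q.eval y * gaussWeight y) * hsq y
  · have h2 := ((hasDerivAt_abs_rpow_mul_self (-a) hy).mul (hasDerivAt_eval_sq L y)).const_mul
      (chi A y)
    have h3 : HasDerivAt (fun y => chi A y * ((y * |y| ^ (-a)) * L.eval (y ^ 2 / 4))) _ y :=
      h2.congr_of_eventuallyEq ((hA.eventually_chi_eq hy).mono fun t ht => by
        simp only [ht, Pi.mul_apply]; ring)
    refine h3.congr_deriv ?_
    rw [hQe]
    ring
  · have h1 := (((hasDerivAt_eval_sq L y).const_mul (1 - a)).add
      (((hasDerivAt_pow 2 y).div_const 2).mul (hasDerivAt_eval_sq L.derivative y))).mul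
      (hasDerivAt_gaussWeight y)
    have h2 := h1.const_mul (chi A y)
    have h3 : HasDerivAt (fun y => chi A y * (Q.eval y * gaussWeight y)) _ y :=
      h2.congr_of_eventuallyEq ((hA.eventually_chi_eq hy).mono fun t ht => by
        simp only [ht, hQe, Pi.mul_apply, Pi.add_apply])
    refine h3.congr_deriv ?_
    have h := congrArg (Polynomial.eval (y ^ 2 / 4)) (laguerrePoly_ode ((1 - a) / 2) m)
    simp only [← hL, Polynomial.eval_mul, Polynomial.eval_sub, Polynomial.eval_X,
      Polynomial.eval_add, Polynomial.eval_C, Polynomial.eval_neg] at h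
    have h4 := abs_rpow_neg_mul (a := a) hy
    simp only [lastWeight, Pi.mul_apply, Pi.add_apply]
    push_cast
    linear_combination (chi A y * y * gaussWeight y) * h
      + (m + (1 - a) / 2) * (chi A y * chi A y) * y * L.eval (y ^ 2 / 4) * gaussWeight y * h4
      + (m + (1 - a) / 2) * y * L.eval (y ^ 2 / 4) * gaussWeight y * hsq y

/-! ### Product functions, product measures and integration by parts along lines. -/

/-- The function `X ↦ ∏ₖ uₖ(Xₖ)`. -/
def prodFun {N : ℕ} (u : Fin (N + 1) → ℝ → ℝ) (X : Space N) : ℝ := ∏ k, u k (X k)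

/-- The measure with density `c ∏ₖ wₖ(Xₖ)`. -/
def muProd {N : ℕ} (c : ℝ) (w : Fin (N + 1) → ℝ → ℝ) : Measure (Space N) :=
  volume.withDensity fun X => ENNReal.ofReal (c * prodFun w X)

section Products

variable {N : ℕ}

lemma measurable_prodFun {u : Fin (N + 1) → ℝ → ℝ} (hu : ∀ k, Measurable (u k)) :
    Measurable (prodFun u) :=
  Finset.measurable_fun_prod _ fun k _ => (hu k).comp (by fun_prop)

lemma prodFun_nonneg {w : Fin (N + 1) → ℝ → ℝ} (hw : ∀ k x, 0 ≤ w k x) (X : Space N) :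
    0 ≤ prodFun w X := Finset.prod_nonneg fun k _ => hw k _

lemma integrable_prodFun {v : Fin (N + 1) → ℝ → ℝ} (hv : ∀ k, Integrable (v k)) :
    Integrable (prodFun v) := by
  have h := Integrable.fintype_prod (μ := fun _ : Fin (N + 1) => (volume : Measure ℝ)) hv
  exact (PiLp.volume_preserving_ofLp (Fin (N + 1))).integrable_comp_of_integrable h

lemma prodFun_mul (u v : Fin (N + 1) → ℝ → ℝ) (X : Space N) :
    prodFun u X * prodFun v X = prodFun (fun k x => u k x * v k x) X := by
  simp only [prodFun, Finset.prod_mul_distrib]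

lemma prodFun_pow (u : Fin (N + 1) → ℝ → ℝ) (n : ℕ) (X : Space N) :
    prodFun u X ^ n = prodFun (fun k x => u k x ^ n) X := by
  simp only [prodFun, Finset.prod_pow]

lemma integral_muProd {c : ℝ} (hc : 0 ≤ c) {w : Fin (N + 1) → ℝ → ℝ} (hwm : ∀ k, Measurable (w k))
    (hw : ∀ k x, 0 ≤ w k x) (f : Space N → ℝ) :
    ∫ X, f X ∂muProd c w = c * ∫ X, f X * prodFun w X := by
  rw [muProd, integral_withDensity_eq_integral_toReal_smul
    (by have := measurable_prodFun hwm; fun_prop) (by simp), ← integral_const_mul]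
  refine integral_congr_ae (Filter.Eventually.of_forall fun X => ?_)
  simp only [smul_eq_mul]
  rw [ENNReal.toReal_ofReal (mul_nonneg hc (prodFun_nonneg hw X))]
  ring

lemma integrable_muProd_iff {c : ℝ} (hc : 0 < c) {w : Fin (N + 1) → ℝ → ℝ}
    (hwm : ∀ k, Measurable (w k)) (hw : ∀ k x, 0 ≤ w k x) {f : Space N → ℝ} :
    Integrable f (muProd c w) ↔ Integrable fun X => f X * prodFun w X := by
  rw [muProd, integrable_withDensity_iff
    (by have := measurable_prodFun hwm; fun_prop) (by simp)]
  have : (fun X => f X * (ENNReal.ofReal (c * prodFun w X)).toReal)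
      = fun X => c * (f X * prodFun w X) := by
    funext X
    rw [ENNReal.toReal_ofReal (mul_nonneg hc.le (prodFun_nonneg hw X))]
    ring
  rw [this, integrable_const_mul_iff (isUnit_iff_ne_zero.mpr hc.ne')]

lemma ae_muProd_of_ae {c : ℝ} {w : Fin (N + 1) → ℝ → ℝ} {p : Space N → Prop}
    (h : ∀ᵐ X, p X) : ∀ᵐ X ∂muProd c w, p X :=
  (withDensity_absolutelyContinuous _ _).ae_le h

lemma memLp_prodFun {c : ℝ} (hc : 0 < c) {w : Fin (N + 1) → ℝ → ℝ} (hwm : ∀ k, Measurable (w k))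
    (hw : ∀ k x, 0 ≤ w k x) {v : Fin (N + 1) → ℝ → ℝ} (hvm : ∀ k, Measurable (v k))
    (hv : ∀ k, Integrable fun x => v k x ^ 2 * w k x) : MemLp (prodFun v) 2 (muProd c w) := by
  rw [memLp_two_iff_integrable_sq (measurable_prodFun hvm).aestronglyMeasurable,
    integrable_muProd_iff hc hwm hw]
  simp only [prodFun_pow, prodFun_mul]
  exact integrable_prodFun hv

/-- The point with `k`-th coordinate `t` and remaining coordinates `z`. -/
def insertPoint (k : Fin (N + 1)) (z : Fin N → ℝ) (t : ℝ) : Space N :=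
  WithLp.toLp 2 (k.insertNth t z)

lemma insertPoint_apply_same (k : Fin (N + 1)) (z : Fin N → ℝ) (t : ℝ) :
    insertPoint k z t k = t := by simp [insertPoint]

lemma insertPoint_apply_succAbove (k : Fin (N + 1)) (z : Fin N → ℝ) (t : ℝ) (j : Fin N) :
    insertPoint k z t (k.succAbove j) = z j := by simp [insertPoint]

lemma insertPoint_eq (k : Fin (N + 1)) (z : Fin N → ℝ) (t : ℝ) :
    insertPoint k z t = insertPoint k z 0 + t • EuclideanSpace.single k (1 : ℝ) := by
  ext l
  rcases Fin.eq_self_or_eq_succAbove k l with rfl | ⟨j, rfl⟩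
  · simp [insertPoint_apply_same]
  · simp [insertPoint_apply_succAbove]

lemma hasDerivAt_insertPoint (k : Fin (N + 1)) (z : Fin N → ℝ) (t : ℝ) :
    HasDerivAt (insertPoint k z) (EuclideanSpace.single k (1 : ℝ)) t := by
  have h : insertPoint k z
      = fun t => insertPoint k z 0 + t • EuclideanSpace.single k (1 : ℝ) :=
    funext (insertPoint_eq k z)
  rw [h]
  exact (((hasDerivAt_id t).smul_const _).const_add _).congr_deriv (one_smul _ _)

theorem integral_eq_zero_of_lines (k : Fin (N + 1)) {Φ : Space N → ℝ} (hΦ : Integrable Φ)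
    (h : ∀ z, ∫ t, Φ (insertPoint k z t) = 0) : ∫ X, Φ X = 0 := by
  have h1 := (PiLp.volume_preserving_toLp (Fin (N + 1)))
  have h2 := (volume_preserving_piFinSuccAbove (fun _ : Fin (N + 1) => ℝ) k).symm
  have h3 : MeasurePreserving (fun p : ℝ × (Fin N → ℝ) => insertPoint k p.2 p.1) := h1.comp h2
  have h4 : MeasurableEmbedding (fun p : ℝ × (Fin N → ℝ) => insertPoint k p.2 p.1) :=
    (MeasurableEquiv.toLp 2 (Fin (N + 1) → ℝ)).measurableEmbedding.comp
      (MeasurableEquiv.piFinSuccAbove (fun _ : Fin (N + 1) => ℝ) k).symm.measurableEmbedding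
  have h5 : Integrable (fun p : ℝ × (Fin N → ℝ) => Φ (insertPoint k p.2 p.1)) :=
    h3.integrable_comp_of_integrable hΦ
  rw [← h3.integral_comp h4, Measure.volume_eq_prod, integral_prod_symm _ h5]
  simp [h]

/-- The fundamental theorem of calculus is applied on the two half-lines separately; continuity at
`0` makes the two boundary terms cancel. -/
theorem integral_eq_zero_of_hasDerivAt_off_zero {F F' : ℝ → ℝ} (hF : Continuous F)
    (hd : ∀ t ≠ 0, HasDerivAt F (F' t) t) (hi : Integrable F') {R : ℝ} (hR : ∀ t, R < |t| → F t = 0) :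
    ∫ t, F' t = 0 := by
  have htop : Filter.Tendsto F Filter.atTop (nhds 0) :=
    tendsto_const_nhds.congr' (by
      filter_upwards [Filter.eventually_gt_atTop R] with t ht
      exact (hR t (ht.trans_le (le_abs_self t))).symm)
  have hbot : Filter.Tendsto F Filter.atBot (nhds 0) :=
    tendsto_const_nhds.congr' (by
      filter_upwards [Filter.eventually_lt_atBot (-R)] with t ht
      exact (hR t ((lt_neg.mp ht).trans_le (neg_le_abs t))).symm)
  have h1 := integral_Ioi_of_hasDerivAt_of_tendsto (a := 0) hF.continuousWithinAt
    (fun t ht => hd t (ne_of_gt ht)) hi.integrableOn htop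
  have h2 := integral_Iic_of_hasDerivAt_of_tendsto (a := 0) hF.continuousWithinAt
    (fun t ht => hd t (ne_of_lt ht)) hi.integrableOn hbot
  have h3 := intervalIntegral.integral_Iic_add_Ioi (b := 0) hi.integrableOn hi.integrableOn
  rw [← h3, h1, h2]
  ring

lemma prodFun_update_insertPoint (v : Fin (N + 1) → ℝ → ℝ) (k : Fin (N + 1)) (f : ℝ → ℝ)
    (z : Fin N → ℝ) (t : ℝ) :
    prodFun (Function.update v k f) (insertPoint k z t) = f t * ∏ j, v (k.succAbove j) (z j) := by
  simp only [prodFun]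
  rw [Fin.prod_univ_succAbove _ k]
  simp only [insertPoint_apply_succAbove, insertPoint_apply_same, Function.update_self,
    Function.update_of_ne (Fin.succAbove_ne k _)]

/-- On a line in direction `k` all other factors are constants, and the sum of the two integrands is
the derivative of a constant times `f φ`. Continuity of `f` is required only on `U`, which is what
admits the Dirichlet flux with its jump at `y = 0`. -/
theorem integral_prodFun_mul_deriv {v : Fin (N + 1) → ℝ → ℝ} (hv : ∀ k, Integrable (v k))
    (k : Fin (N + 1)) {f f' : ℝ → ℝ} (hf : Integrable f) (hf' : Integrable f')
    (hd : ∀ t ≠ 0, HasDerivAt f (f' t) t) {U : Set (Space N)}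
    (hc : ∀ X ∈ U, ContinuousAt f (X k)) {φ : Space N → ℝ} (hφ : φ ∈ testFunctions U) :
    ∫ X, prodFun (Function.update v k f) X * fderiv ℝ φ X (EuclideanSpace.single k 1)
      = -∫ X, prodFun (Function.update v k f') X * φ X := by
  obtain ⟨hφs, hφc, hφU⟩ := hφ
  have hup : ∀ g : ℝ → ℝ, Integrable g → ∀ j, Integrable (Function.update v k g j) := by
    intro g hg j
    by_cases h : j = k
    · subst h; simpa using hg
    · simpa [h] using hv j
  have hdc : Continuous fun X => fderiv ℝ φ X (EuclideanSpace.single k 1) :=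
    (hφs.continuous_fderiv (by simp)).clm_apply continuous_const
  have hds : HasCompactSupport fun X => fderiv ℝ φ X (EuclideanSpace.single k 1) :=
    hφc.fderiv_apply ℝ _
  obtain ⟨C, hC⟩ := hφc.exists_bound_of_continuous hφs.continuous
  obtain ⟨D, hD⟩ := hds.exists_bound_of_continuous hdc
  have i1 := (integrable_prodFun (hup f hf)).mul_bdd (c := D) hdc.aestronglyMeasurable
    (Filter.Eventually.of_forall hD)
  have i2 := (integrable_prodFun (hup f' hf')).mul_bdd (c := C) hφs.continuous.aestronglyMeasurable
    (Filter.Eventually.of_forall hC)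
  rw [eq_neg_iff_add_eq_zero, ← integral_add i1 i2]
  refine integral_eq_zero_of_lines k (i1.add i2) fun z => ?_
  set γ := insertPoint k z with hγ
  have hγc : Continuous γ := continuous_iff_continuousAt.mpr fun t =>
    (hasDerivAt_insertPoint k z t).continuousAt
  set R := ∏ j, v (k.succAbove j) (z j) with hR
  have hφγ : ∀ t, HasDerivAt (fun t => φ (γ t)) (fderiv ℝ φ (γ t) (EuclideanSpace.single k 1)) t :=
    fun t => ((hφs.differentiable (by simp)).differentiableAt.hasFDerivAt).comp_hasDerivAt t
      (hasDerivAt_insertPoint k z t)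
  -- Where the line meets the support of `φ` it lies in `U`, and `f` is continuous there; elsewhere
  -- `φ` vanishes nearby, whatever `f` does.
  have hcont : Continuous fun t => R * (f t * φ (γ t)) := by
    refine continuous_const.mul (continuous_iff_continuousAt.mpr fun t => ?_)
    by_cases ht : γ t ∈ tsupport φ
    · have h := hc _ (hφU ht)
      rw [insertPoint_apply_same] at h
      exact h.mul (hφγ t).continuousAt
    · have h1 := (notMem_tsupport_iff_eventuallyEq.mp ht)
      have h2 : ∀ᶠ s in nhds t, φ (γ s) = 0 := hγc.continuousAt.eventually h1
      refine (continuousAt_const (y := (0 : ℝ))).congr ?_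
      filter_upwards [h2] with s hs
      simp [hs]
  obtain ⟨B, hB⟩ := hφc.isCompact.isBounded.exists_norm_le
  have hvan : ∀ t, B < |t| → R * (f t * φ (γ t)) = 0 := by
    intro t ht
    have : γ t ∉ tsupport φ := fun h => by
      have h1 := hB _ h
      have h2 := PiLp.norm_apply_le (γ t) k
      rw [insertPoint_apply_same, Real.norm_eq_abs] at h2
      linarith
    rw [image_eq_zero_of_notMem_tsupport this]
    ring
  have hint : Integrable fun t => R * (f' t * φ (γ t)
      + f t * fderiv ℝ φ (γ t) (EuclideanSpace.single k 1)) :=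
    ((hf'.mul_bdd (c := C) (hφs.continuous.comp hγc).aestronglyMeasurable
      (Filter.Eventually.of_forall fun t => hC _)).add
      (hf.mul_bdd (c := D) (hdc.comp hγc).aestronglyMeasurable
      (Filter.Eventually.of_forall fun t => hD _))).const_mul R
  rw [← integral_eq_zero_of_hasDerivAt_off_zero hcont
    (fun t ht => ((hd t ht).mul (hφγ t)).const_mul R) hint hvan]
  refine integral_congr_ae (Filter.Eventually.of_forall fun t => ?_)
  simp only [hγ, prodFun_update_insertPoint]
  ring

end Products

/-! ### Membership in the Sobolev space by truncation. -/

lemma tendsto_toLp_of_eventually_eq {α E : Type*} [MeasurableSpace α] [NormedAddCommGroup E]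
    {μ : Measure α} {F : ℕ → α → E} {f : α → E} {b : α → ℝ} (hF : ∀ n, MemLp (F n) 2 μ)
    (hf : MemLp f 2 μ) (hb : MemLp b 2 μ) (hbound : ∀ n, ∀ᵐ x ∂μ, ‖F n x‖ ≤ b x)
    (hev : ∀ᵐ x ∂μ, ∀ᶠ n in Filter.atTop, F n x = f x) :
    Filter.Tendsto (fun n => (hF n).toLp (F n)) Filter.atTop (nhds (hf.toLp f)) := by
  rw [Lp.tendsto_Lp_iff_tendsto_eLpNorm'']
  have key : Filter.Tendsto (fun n => ∫⁻ x, ‖(F n - f) x‖ₑ ^ (2 : ℝ) ∂μ) Filter.atTop (nhds 0) := by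
    have h0 : (∫⁻ _ : α, 0 ∂μ) = 0 := lintegral_zero
    rw [← h0]
    -- The limit inherits the bound `b` because it agrees with some `F m` at almost every point, so
    -- the difference is at most `2 b`.
    have h2b : MemLp (fun x => 2 * b x) 2 μ := hb.const_mul 2
    refine tendsto_lintegral_of_dominated_convergence' (fun x => ‖2 * b x‖ₑ ^ (2 : ℝ))
      (fun n => ((hF n).sub hf).aestronglyMeasurable.enorm.pow_const 2) (fun n => ?_) ?_ ?_
    · filter_upwards [ae_all_iff.mpr hbound, hev] with x h1 h2
      obtain ⟨m, hm⟩ := h2.exists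
      have h3 : ‖f x‖ ≤ b x := hm ▸ h1 m
      refine ENNReal.rpow_le_rpow ?_ (by norm_num)
      rw [enorm_le_iff_norm_le, Pi.sub_apply, Real.norm_eq_abs]
      exact (norm_sub_le _ _).trans (by linarith [le_abs_self (2 * b x), h1 n])
    · have := lintegral_rpow_enorm_lt_top_of_eLpNorm_lt_top (p := 2) (by norm_num) (by norm_num)
        h2b.2
      simpa using this.ne
    · filter_upwards [hev] with x hx
      refine tendsto_const_nhds.congr' ?_
      filter_upwards [hx] with n hn
      simp [hn]
  have h1 : (fun n => eLpNorm (F n - f) 2 μ)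
      = fun n => (∫⁻ x, ‖(F n - f) x‖ₑ ^ (2 : ℝ) ∂μ) ^ (1 / (2 : ℝ)) := by
    funext n
    rw [eLpNorm_eq_lintegral_rpow_enorm_toReal (by norm_num) (by norm_num)]
    simp
  rw [h1]
  have h2 := key.ennrpow_const (1 / (2 : ℝ))
  rwa [ENNReal.zero_rpow_of_pos (by norm_num)] at h2

section Cutoff

variable {N : ℕ}

lemma HasGradientAt.mul_fun {η e : Space N → ℝ} {g X : Space N} (he : HasGradientAt e g X)
    (hη : DifferentiableAt ℝ η X) :
    HasGradientAt (fun X => η X * e X) (η X • g + e X • gradient η X) X := by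
  rw [hasGradientAt_iff_hasFDerivAt] at he ⊢
  have := hη.hasGradientAt
  rw [hasGradientAt_iff_hasFDerivAt] at this
  refine (this.mul he).congr_fderiv ?_
  simp [map_add]

lemma norm_gradient_eq (η : Space N → ℝ) (X : Space N) : ‖gradient η X‖ = ‖fderiv ℝ η X‖ := by
  rw [gradient, LinearIsometryEquiv.norm_map]

/-- The gradient of `η n * e` is `η n • g + e • ∇(η n)`, dominated by `‖g‖ + |B e|`. The second term
need not be small uniformly: at almost every point it is eventually zero, so dominated convergence
suffices. -/
theorem mem_sobolev_of_cutoff {μ : Measure (Space N)} {U : Set (Space N)} {e : Space N → ℝ}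
    {g : Space N → Space N} (η : ℕ → Space N → ℝ) (B : Space N → ℝ)
    (he : MemLp e 2 μ) (hg : MemLp g 2 μ) (hgrad : ∀ᵐ X ∂μ, HasGradientAt e (g X) X)
    (hηd : ∀ n, Differentiable ℝ (η n)) (hη : ∀ n X, |η n X| ≤ 1)
    (hηB : ∀ n X, ‖fderiv ℝ (η n) X‖ ≤ B X)
    (hev : ∀ᵐ X ∂μ, ∀ᶠ n in Filter.atTop, ∀ᶠ Y in nhds X, η n Y = 1)
    (htest : ∀ n, (fun X => η n X * e X) ∈ testFunctions U)
    (hB : MemLp (fun X => B X * e X) 2 μ) : (he.toLp, hg.toLp) ∈ sobolev μ U := by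
  have hφ : ∀ n, ∀ X, ‖η n X * e X‖ ≤ ‖e X‖ := fun n X => by
    rw [norm_mul]
    exact mul_le_of_le_one_left (norm_nonneg _) (hη n X)
  have hφL : ∀ n, MemLp (fun X => η n X * e X) 2 μ := fun n =>
    he.of_le (htest n).1.continuous.aestronglyMeasurable (Filter.Eventually.of_forall (hφ n))
  have hb : MemLp (fun X => ‖g X‖ + ‖B X * e X‖) 2 μ := hg.norm.add hB.norm
  have hG : ∀ n, ∀ᵐ X ∂μ, ‖gradient (fun X => η n X * e X) X‖ ≤ ‖g X‖ + ‖B X * e X‖ := by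
    intro n
    filter_upwards [hgrad] with X hX
    rw [(HasGradientAt.mul_fun hX (hηd n X)).gradient]
    refine (norm_add_le _ _).trans (add_le_add ?_ ?_)
    · rw [norm_smul]
      exact mul_le_of_le_one_left (norm_nonneg _) (hη n X)
    · rw [norm_smul, norm_mul, mul_comm, norm_gradient_eq]
      gcongr
      exact (hηB n X).trans (le_abs_self _)
  have hGL : ∀ n, MemLp (gradient (fun X => η n X * e X)) 2 μ := fun n => by
    refine hb.of_le ?_ ((hG n).mono fun X h => h.trans (le_abs_self _))
    have h1 : Continuous (fderiv ℝ fun X => η n X * e X) := (htest n).1.continuous_fderiv (by simp)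
    exact ((LinearIsometryEquiv.continuous _).comp h1).aestronglyMeasurable
  have t1 := tendsto_toLp_of_eventually_eq hφL he he.norm
    (fun n => Filter.Eventually.of_forall (hφ n)) (by
      filter_upwards [hev] with X hX
      filter_upwards [hX] with n hn
      rw [hn.self_of_nhds, one_mul])
  have t2 := tendsto_toLp_of_eventually_eq hGL hg hb hG (by
      filter_upwards [hev, hgrad] with X hX hX'
      filter_upwards [hX] with n hn
      have h1 : (fun X => η n X * e X) =ᶠ[nhds X] e := hn.mono fun Y hY => by simp [hY]
      rw [gradient, h1.fderiv_eq]
      exact hX'.gradient)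
  refine mem_closure_of_tendsto (t1.prodMk_nhds t2) (Filter.Eventually.of_forall fun n => ?_)
  exact ⟨_, htest n, (hφL n).coeFn_toLp, (hGL n).coeFn_toLp⟩

/-- A smooth function which is `1` on the unit ball and vanishes off the ball of radius `2`. -/
def bump (N : ℕ) : ContDiffBump (0 : Space N) := ⟨1, 2, one_pos, one_lt_two⟩

/-- A smooth function with bounded support, equal to `1` on the ball of radius `n + 1`. -/
def farCutoff (N n : ℕ) (X : Space N) : ℝ := bump N (((n : ℝ) + 1)⁻¹ • X)

lemma contDiff_farCutoff (n : ℕ) : ContDiff ℝ ∞ (farCutoff N n) :=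
  (bump N).contDiff.comp (contDiff_const_smul _)

lemma abs_farCutoff_le (n : ℕ) (X : Space N) : |farCutoff N n X| ≤ 1 := by
  rw [farCutoff, abs_of_nonneg (bump N).nonneg]
  exact (bump N).le_one

lemma hasCompactSupport_farCutoff (n : ℕ) : HasCompactSupport (farCutoff N n) :=
  (bump N).hasCompactSupport.comp_smul (by positivity)

lemma exists_norm_fderiv_farCutoff_le (N : ℕ) :
    ∃ M, 0 ≤ M ∧ ∀ n X, ‖fderiv ℝ (farCutoff N n) X‖ ≤ M := by
  obtain ⟨M, hM⟩ := ((bump N).hasCompactSupport.fderiv (𝕜 := ℝ)).exists_bound_of_continuous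
    ((bump N).contDiff.continuous_fderiv (n := 1) (by simp))
  refine ⟨M, (norm_nonneg _).trans (hM 0), fun n X => ?_⟩
  have h : fderiv ℝ (farCutoff N n) X
      = ((n : ℝ) + 1)⁻¹ • fderiv ℝ (bump N) (((n : ℝ) + 1)⁻¹ • X) := by
    have h0 : farCutoff N n = fun X => bump N (((n : ℝ) + 1)⁻¹ • X) := rfl
    rw [h0, fderiv_comp_smul]
  rw [h, norm_smul, Real.norm_of_nonneg (by positivity)]
  refine (mul_le_of_le_one_left (norm_nonneg _) (inv_le_one_of_one_le₀ ?_)).trans (hM _)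
  have : (0 : ℝ) ≤ n := Nat.cast_nonneg n
  linarith

lemma eventually_farCutoff_eq_one (X : Space N) :
    ∀ᶠ n : ℕ in Filter.atTop, ∀ᶠ Y in nhds X, farCutoff N n Y = 1 := by
  obtain ⟨m, hm⟩ := exists_nat_gt ‖X‖
  filter_upwards [Filter.eventually_ge_atTop m] with n hn
  have h1 : ‖X‖ < n + 1 := by
    have : (m : ℝ) ≤ n := by exact_mod_cast hn
    linarith
  filter_upwards [(continuous_norm.continuousAt (x := X)).eventually (gt_mem_nhds h1)] with Y hY
  refine (bump N).one_of_mem_closedBall ?_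
  rw [mem_closedBall_zero_iff, norm_smul, Real.norm_of_nonneg (by positivity),
    inv_mul_le_iff₀ (by positivity)]
  simpa [bump] using hY.le

theorem mem_sobolev_of_contDiff {μ : Measure (Space N)} {e : Space N → ℝ}
    {g : Space N → Space N} (he : MemLp e 2 μ) (hg : MemLp g 2 μ)
    (hgrad : ∀ᵐ X ∂μ, HasGradientAt e (g X) X) (hs : ContDiff ℝ ∞ e) :
    (he.toLp, hg.toLp) ∈ sobolev μ Set.univ := by
  obtain ⟨M, -, hM⟩ := exists_norm_fderiv_farCutoff_le N
  refine mem_sobolev_of_cutoff (farCutoff N) (fun _ => M) he hg hgrad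
    (fun n => (contDiff_farCutoff n).differentiable (by simp)) abs_farCutoff_le hM
    (Filter.Eventually.of_forall eventually_farCutoff_eq_one)
    (fun n => ⟨(contDiff_farCutoff n).mul hs, (hasCompactSupport_farCutoff n).mul_right,
      Set.subset_univ _⟩) (he.const_mul M)

/-- A smooth function of one variable, vanishing near `0` and equal to `1` away from `0`. -/
def gap (t : ℝ) : ℝ := Real.smoothTransition (t ^ 2 - 1)

lemma contDiff_gap : ContDiff ℝ ∞ gap :=
  Real.smoothTransition.contDiff.comp ((contDiff_id.pow 2).sub contDiff_const)

lemma abs_gap_le (t : ℝ) : |gap t| ≤ 1 := by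
  rw [gap, abs_of_nonneg (Real.smoothTransition.nonneg _)]
  exact Real.smoothTransition.le_one _

lemma gap_eq_zero {t : ℝ} (ht : |t| ≤ 1) : gap t = 0 := by
  refine Real.smoothTransition.zero_of_nonpos ?_
  have := sq_abs t
  nlinarith [abs_nonneg t]

lemma gap_eq_one {t : ℝ} (ht : 2 ≤ |t|) : gap t = 1 := by
  refine Real.smoothTransition.one_of_one_le ?_
  have := sq_abs t
  nlinarith [abs_nonneg t]

/-- The quantity `t gap'(t)` is invariant under scaling, so one constant bounds `|y| |∇η|` for all
the dilated cutoffs at once. -/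
lemma exists_abs_mul_deriv_gap_le : ∃ K, 0 ≤ K ∧ ∀ t, |t * deriv gap t| ≤ K := by
  have hc : Continuous fun t => t * deriv gap t :=
    continuous_id.mul (contDiff_gap.continuous_deriv (by simp))
  have hs : HasCompactSupport fun t => t * deriv gap t := by
    refine HasCompactSupport.intro (isCompact_Icc (a := (-2 : ℝ)) (b := 2)) fun t ht => ?_
    have h2 : 2 < |t| := by
      by_contra h
      exact ht (abs_le.mp (not_lt.mp h))
    have h3 : gap =ᶠ[nhds t] fun _ => 1 := by
      filter_upwards [(continuous_abs.continuousAt (x := t)).eventually (lt_mem_nhds h2)] with s hs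
      exact gap_eq_one hs.le
    rw [h3.deriv_eq, deriv_const, mul_zero]
  obtain ⟨K, hK⟩ := hs.exists_bound_of_continuous hc
  exact ⟨K, (norm_nonneg _).trans (hK 0), hK⟩

/-- A cutoff away from the hyperplane `{y = 0}`. -/
def nearCutoff (N n : ℕ) (X : Space N) : ℝ := gap (((n : ℝ) + 1) * yCoord X)

/-- The last coordinate, as a continuous linear functional. -/
def lastProj (N : ℕ) : Space N →L[ℝ] ℝ := EuclideanSpace.proj (Fin.last N)

lemma contDiff_yCoord : ContDiff ℝ ∞ (yCoord : Space N → ℝ) := (lastProj N).contDiff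

lemma norm_lastProj_le : ‖lastProj N‖ ≤ 1 :=
  ContinuousLinearMap.opNorm_le_bound _ zero_le_one fun X => by
    rw [one_mul]; exact PiLp.norm_apply_le X _

lemma contDiff_nearCutoff (n : ℕ) : ContDiff ℝ ∞ (nearCutoff N n) :=
  contDiff_gap.comp (contDiff_const.mul contDiff_yCoord)

lemma exists_norm_fderiv_nearCutoff_le (N : ℕ) :
    ∃ K, 0 ≤ K ∧ ∀ n X, ‖fderiv ℝ (nearCutoff N n) X‖ ≤ K / |yCoord X| := by
  obtain ⟨K, hK0, hK⟩ := exists_abs_mul_deriv_gap_le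
  refine ⟨K, hK0, fun n X => ?_⟩
  have h1 : HasFDerivAt (nearCutoff N n)
      (deriv gap (((n : ℝ) + 1) * yCoord X) • (((n : ℝ) + 1) • lastProj N)) X :=
    ((contDiff_gap.differentiable (by simp)).differentiableAt.hasDerivAt).comp_hasFDerivAt X
      ((lastProj N).hasFDerivAt.const_mul _)
  rw [h1.fderiv, norm_smul, norm_smul, Real.norm_eq_abs, Real.norm_of_nonneg (by positivity)]
  by_cases hy : yCoord X = 0
  · have h3 : gap =ᶠ[nhds (((n : ℝ) + 1) * yCoord X)] fun _ => 0 := by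
      rw [hy, mul_zero]
      filter_upwards [Metric.ball_mem_nhds (0 : ℝ) one_pos] with s hs
      exact gap_eq_zero (by simpa using (mem_ball_zero_iff.mp hs).le)
    rw [h3.deriv_eq, deriv_const, hy]
    simp
  · rw [le_div_iff₀ (abs_pos.mpr hy)]
    have h2 := hK (((n : ℝ) + 1) * yCoord X)
    rw [abs_mul, abs_mul, abs_of_nonneg (by positivity : (0 : ℝ) ≤ (n : ℝ) + 1)] at h2
    refine le_trans ?_ h2
    have h3 := norm_lastProj_le (N := N)
    calc |deriv gap (((n : ℝ) + 1) * yCoord X)| * (((n : ℝ) + 1) * ‖lastProj N‖) * |yCoord X|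
        ≤ |deriv gap (((n : ℝ) + 1) * yCoord X)| * (((n : ℝ) + 1) * 1) * |yCoord X| := by gcongr
      _ = _ := by ring

lemma eventually_nearCutoff_eq_zero (n : ℕ) {X : Space N} (hX : yCoord X = 0) :
    ∀ᶠ Y in nhds X, nearCutoff N n Y = 0 := by
  have h1 : Continuous fun X : Space N => ((n : ℝ) + 1) * yCoord X :=
    continuous_const.mul contDiff_yCoord.continuous
  have h2 : ∀ᶠ Y in nhds X, |((n : ℝ) + 1) * yCoord Y| < 1 :=
    (h1.abs.continuousAt (x := X)).eventually (gt_mem_nhds (by simp [hX]))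
  exact h2.mono fun Y hY => gap_eq_zero hY.le

lemma eventually_nearCutoff_eq_one {X : Space N} (hX : yCoord X ≠ 0) :
    ∀ᶠ n : ℕ in Filter.atTop, ∀ᶠ Y in nhds X, nearCutoff N n Y = 1 := by
  have hX' := abs_pos.mpr hX
  obtain ⟨m, hm⟩ := exists_nat_gt (2 / |yCoord X|)
  filter_upwards [Filter.eventually_ge_atTop m] with n hn
  have h1 : Continuous fun X : Space N => ((n : ℝ) + 1) * yCoord X :=
    continuous_const.mul contDiff_yCoord.continuous
  have h3 : 2 < |((n : ℝ) + 1) * yCoord X| := by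
    have : (m : ℝ) ≤ n := by exact_mod_cast hn
    rw [div_lt_iff₀ hX'] at hm
    rw [abs_mul, abs_of_nonneg (by positivity : (0 : ℝ) ≤ (n : ℝ) + 1)]
    nlinarith
  exact ((h1.abs.continuousAt (x := X)).eventually (lt_mem_nhds h3)).mono
    fun Y hY => gap_eq_one hY.le

/-- The product of the far and near cutoffs has gradient at most `M + K/|y|`. The assumption that
`e/|y|` is square integrable controls the near part, and multiplication by the near cutoff removes
the possible singularity of `e` on `{y = 0}`. -/
theorem mem_sobolev_of_contDiffAt {μ : Measure (Space N)} {U : Set (Space N)} {e : Space N → ℝ}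
    {g : Space N → Space N} (he : MemLp e 2 μ) (hg : MemLp g 2 μ)
    (hgrad : ∀ᵐ X ∂μ, HasGradientAt e (g X) X) (hy : ∀ᵐ X ∂μ, yCoord X ≠ 0)
    (hs : ∀ X, yCoord X ≠ 0 → ContDiffAt ℝ ∞ e X) (hU : ∀ X ∈ tsupport e, yCoord X ≠ 0 → X ∈ U)
    (hey : MemLp (fun X => |yCoord X|⁻¹ * e X) 2 μ) :
    (he.toLp, hg.toLp) ∈ sobolev μ U := by
  obtain ⟨M, hM0, hM⟩ := exists_norm_fderiv_farCutoff_le N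
  obtain ⟨K, hK0, hK⟩ := exists_norm_fderiv_nearCutoff_le N
  have hd : ∀ n, ContDiff ℝ ∞ fun X => farCutoff N n X * nearCutoff N n X :=
    fun n => (contDiff_farCutoff n).mul (contDiff_nearCutoff n)
  have hz : ∀ n X, yCoord X = 0 →
      ∀ᶠ Y in nhds X, farCutoff N n Y * nearCutoff N n Y * e Y = 0 := fun n X hX =>
    (eventually_nearCutoff_eq_zero n hX).mono fun Y hY => by simp [hY]
  refine mem_sobolev_of_cutoff (fun n X => farCutoff N n X * nearCutoff N n X)
    (fun X => M + K / |yCoord X|) he hg hgrad (fun n => (hd n).differentiable (by simp))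
    (fun n X => ?_) (fun n X => ?_) ?_ (fun n => ⟨?_, ?_, ?_⟩) ?_
  · rw [abs_mul]
    exact mul_le_one₀ (abs_farCutoff_le n X) (abs_nonneg _) (abs_gap_le _)
  · rw [fderiv_fun_mul ((contDiff_farCutoff n).differentiable (by simp)).differentiableAt
      ((contDiff_nearCutoff n).differentiable (by simp)).differentiableAt]
    refine (norm_add_le _ _).trans ((add_le_add ?_ ?_).trans_eq (add_comm _ _))
    · rw [norm_smul]
      exact (mul_le_of_le_one_left (norm_nonneg _) (abs_farCutoff_le n X)).trans (hK n X)
    · rw [norm_smul]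
      exact (mul_le_of_le_one_left (norm_nonneg _) (abs_gap_le _)).trans (hM n X)
  · filter_upwards [hy] with X hX
    filter_upwards [eventually_farCutoff_eq_one X, eventually_nearCutoff_eq_one hX] with n h1 h2
    filter_upwards [h1, h2] with Y h3 h4
    simp [h3, h4]
  · refine contDiff_iff_contDiffAt.mpr fun X => ?_
    by_cases hX : yCoord X = 0
    · exact contDiffAt_const.congr_of_eventuallyEq (hz n X hX)
    · exact (hd n).contDiffAt.mul (hs X hX)
  · exact ((hasCompactSupport_farCutoff n).mul_right).mul_right
  · intro X hX
    refine hU X (tsupport_mul_subset_right hX) fun h => ?_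
    exact (notMem_tsupport_iff_eventuallyEq.mpr (hz n X h)) hX
  · refine ((he.const_mul M).add (hey.const_mul K)).ae_eq (Filter.Eventually.of_forall fun X => ?_)
    simp only [Pi.add_apply]
    ring

end Cutoff

/-! ### Products of one-dimensional eigenfunctions are separated modes. -/

section ProductModes

variable {N : ℕ}

lemma ae_coord_ne_zero : ∀ᵐ X : Space N, ∀ k, X k ≠ 0 := by
  rw [ae_all_iff]
  intro k
  have h := (Measure.quasiMeasurePreserving_eval
    (μ := fun _ : Fin (N + 1) => (volume : Measure ℝ)) k).comp
    (PiLp.volume_preserving_ofLp (Fin (N + 1))).quasiMeasurePreserving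
  exact h.ae ae_ne_zero

/-- The gradient of `prodFun u`, when the functions `d k` are the derivatives of the `u k`. -/
def prodGrad (u d : Fin (N + 1) → ℝ → ℝ) (k : Fin (N + 1)) (X : Space N) : Space N :=
  prodFun (Function.update u k (d k)) X • EuclideanSpace.single k (1 : ℝ)

lemma prodFun_update (u : Fin (N + 1) → ℝ → ℝ) (k : Fin (N + 1)) (g : ℝ → ℝ) (X : Space N) :
    prodFun (Function.update u k g) X = g (X k) * ∏ j ∈ Finset.univ.erase k, u j (X j) := by
  rw [prodFun, ← Finset.mul_prod_erase _ _ (Finset.mem_univ k), Function.update_self]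
  congr 1
  exact Finset.prod_congr rfl fun j hj => by rw [Function.update_of_ne (Finset.ne_of_mem_erase hj)]

lemma hasGradientAt_prodFun {u d : Fin (N + 1) → ℝ → ℝ} {X : Space N}
    (h : ∀ k, HasDerivAt (u k) (d k (X k)) (X k)) :
    HasGradientAt (prodFun u) (∑ k, prodGrad u d k X) X := by
  rw [hasGradientAt_iff_hasFDerivAt]
  have h1 : ∀ k, HasFDerivAt (fun X : Space N => u k (X k))
      (d k (X k) • (EuclideanSpace.proj k : Space N →L[ℝ] ℝ)) X := fun k =>
    (h k).comp_hasFDerivAt X (EuclideanSpace.proj k : Space N →L[ℝ] ℝ).hasFDerivAt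
  have h2 := HasFDerivAt.finsetProd (u := Finset.univ) fun k _ => h1 k
  refine h2.congr_fderiv ?_
  ext v
  simp only [map_sum, prodGrad, prodFun_update, map_smul]
  simp only [sum_apply, smul_apply, InnerProductSpace.toDual_apply_apply,
    EuclideanSpace.inner_single_left]
  refine Finset.sum_congr rfl fun k _ => ?_
  simp
  ring

lemma contDiffAt_prodFun {u : Fin (N + 1) → ℝ → ℝ} {X : Space N}
    (h : ∀ k, ContDiffAt ℝ ∞ (u k) (X k)) : ContDiffAt ℝ ∞ (prodFun u) X :=
  contDiffAt_prod fun k _ => (h k).comp X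
    (EuclideanSpace.proj k : Space N →L[ℝ] ℝ).contDiff.contDiffAt

lemma inner_prodGrad (u d : Fin (N + 1) → ℝ → ℝ) (k : Fin (N + 1)) (φ : Space N → ℝ) (X : Space N) :
    inner ℝ (prodGrad u d k X) (gradient φ X)
      = prodFun (Function.update u k (d k)) X
        * fderiv ℝ φ X (EuclideanSpace.single k 1) := by
  rw [prodGrad, real_inner_smul_left, real_inner_comm, gradient, InnerProductSpace.toDual_symm_apply]

variable {c : ℝ} {w u d f : Fin (N + 1) → ℝ → ℝ} {lam : Fin (N + 1) → ℝ}

lemma memLp_prodFun_of_factor (hc : 0 < c) (hwm : ∀ k, Measurable (w k)) (hw : ∀ k x, 0 ≤ w k x)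
    (hF : ∀ k, Factor (w k) (u k) (d k) (f k) (lam k)) : MemLp (prodFun u) 2 (muProd c w) :=
  memLp_prodFun hc hwm hw (fun k => (hF k).measurable_u) fun k => (hF k).integrable_sq

lemma memLp_prodGrad (hc : 0 < c) (hwm : ∀ k, Measurable (w k)) (hw : ∀ k x, 0 ≤ w k x)
    (hF : ∀ k, Factor (w k) (u k) (d k) (f k) (lam k)) (k : Fin (N + 1)) :
    MemLp (prodGrad u d k) 2 (muProd c w) := by
  have h : MemLp (prodFun (Function.update u k (d k))) 2 (muProd c w) := by
    refine memLp_prodFun hc hwm hw (fun j => ?_) fun j => ?_ <;> by_cases hj : j = k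
    · subst hj; simpa using (hF j).measurable_d
    · simpa [hj] using (hF j).measurable_u
    · subst hj; simpa using (hF j).integrable_deriv_sq
    · simpa [hj] using (hF j).integrable_sq
  exact (ContinuousLinearMap.toSpanSingleton ℝ (EuclideanSpace.single k (1 : ℝ))).comp_memLp' h

/-- Multiplied by the weight, the `k`-th partial derivative of the product becomes the product of
the `u j * w j` with the `k`-th factor replaced by the flux `f k`. Integration by parts in direction
`k` then calls for the derivative of the flux, which is `-lam k * u k * w k`. -/
lemma integral_prodGrad_inner (hc : 0 < c) (hwm : ∀ k, Measurable (w k)) (hw : ∀ k x, 0 ≤ w k x)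
    (hF : ∀ k, Factor (w k) (u k) (d k) (f k) (lam k)) {U : Set (Space N)}
    (hcont : ∀ k, ∀ X ∈ U, ContinuousAt (f k) (X k)) (k : Fin (N + 1)) {φ : Space N → ℝ}
    (hφ : φ ∈ testFunctions U) :
    ∫ X, inner ℝ (prodGrad u d k X) (gradient φ X) ∂muProd c w
      = lam k * ∫ X, prodFun u X * φ X ∂muProd c w := by
  rw [integral_muProd hc.le hwm hw, integral_muProd hc.le hwm hw]
  set v : Fin (N + 1) → ℝ → ℝ := fun j x => u j x * w j x with hv
  have h1 : ∫ X, inner ℝ (prodGrad u d k X) (gradient φ X) * prodFun w X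
      = ∫ X, prodFun (Function.update v k (f k)) X * fderiv ℝ φ X (EuclideanSpace.single k 1) := by
    refine integral_congr_ae (ae_coord_ne_zero.mono fun X hX => ?_)
    simp only
    rw [inner_prodGrad, prodFun_update, prodFun_update, (hF k).flux_eq _ (hX k), prodFun,
      ← Finset.mul_prod_erase _ (fun j => w j (X j)) (Finset.mem_univ k)]
    simp only [hv, Finset.prod_mul_distrib]
    ring
  have h2 : ∫ X, prodFun u X * φ X * prodFun w X
      = ∫ X, prodFun v X * φ X := by
    refine integral_congr_ae (Filter.Eventually.of_forall fun X => ?_)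
    simp only [hv, ← prodFun_mul]
    ring
  have h3 := integral_prodFun_mul_deriv (v := v) (fun j => (hF j).integrable_mul) k
    (hF k).integrable_flux (((hF k).integrable_mul.const_mul (lam k)).neg)
    (hF k).hasDerivAt_flux (hcont k) hφ
  rw [h1, h2, h3, ← integral_neg, mul_left_comm, ← integral_const_mul (lam k)]
  congr 1
  refine integral_congr_ae (Filter.Eventually.of_forall fun X => ?_)
  have h4 : prodFun v X = v k (X k) * ∏ j ∈ Finset.univ.erase k, v j (X j) := by
    rw [prodFun, ← Finset.mul_prod_erase _ _ (Finset.mem_univ k)]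
  simp only [prodFun_update, h4, Pi.neg_apply]
  simp only [hv]
  ring

theorem isMode_prodFun (hc : 0 < c) (hwm : ∀ k, Measurable (w k)) (hw : ∀ k x, 0 ≤ w k x)
    (hF : ∀ k, Factor (w k) (u k) (d k) (f k) (lam k)) {U : Set (Space N)}
    (hcont : ∀ k, ∀ X ∈ U, ContinuousAt (f k) (X k)) (hu : MemLp (prodFun u) 2 (muProd c w))
    (hS : ∀ hg : MemLp (fun X => ∑ k, prodGrad u d k X) 2 (muProd c w),
      (∀ᵐ X ∂muProd c w, HasGradientAt (prodFun u) (∑ k, prodGrad u d k X) X) →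
      (hu.toLp, hg.toLp) ∈ sobolev (muProd c w) U) :
    IsMode (muProd c w) U hu.toLp lam := by
  have hG := memLp_prodGrad hc hwm hw hF
  have hsum : MemLp (fun X => ∑ k, prodGrad u d k X) 2 (muProd c w) :=
    memLp_finsetSum _ fun k _ => hG k
  refine ⟨fun k => (hG k).toLp (prodGrad u d k), fun k => ?_, ?_, fun k => ?_⟩
  · filter_upwards [(hG k).coeFn_toLp] with X hX l hl
    rw [hX]
    simp [prodGrad, hl]
  · have h1 : ∑ k, (hG k).toLp = hsum.toLp := by
      refine Lp.ext ?_
      have h2 : ∀ᵐ X ∂muProd c w, ∀ k, ((hG k).toLp (prodGrad u d k)) X = prodGrad u d k X :=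
        ae_all_iff.mpr fun k => (hG k).coeFn_toLp
      filter_upwards [hsum.coeFn_toLp, h2,
        Lp.coeFn_finsetSum Finset.univ fun k => (hG k).toLp] with X h3 h4 h5
      rw [h3, h5, Finset.sum_apply]
      exact Finset.sum_congr rfl fun k _ => h4 k
    rw [h1]
    refine hS hsum (ae_muProd_of_ae (ae_coord_ne_zero.mono fun X hX => ?_))
    exact hasGradientAt_prodFun fun k => (hF k).hasDerivAt _ (hX k)
  · have hcl : IsClosed {q : Lp ℝ 2 (muProd c w) × Lp (Space N) 2 (muProd c w) |
        inner ℝ ((hG k).toLp) q.2 = lam k * inner ℝ (hu.toLp) q.1} :=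
      isClosed_eq (by fun_prop) (by fun_prop)
    refine closure_minimal (fun q hq => ?_) hcl
    obtain ⟨φ, hφ, h1, h2⟩ := hq
    change inner ℝ ((hG k).toLp (prodGrad u d k)) q.2 = lam k * inner ℝ (hu.toLp (prodFun u)) q.1
    rw [L2.inner_def, L2.inner_def]
    have h3 := integral_prodGrad_inner hc hwm hw hF hcont k hφ
    refine Eq.trans (integral_congr_ae ?_) (h3.trans ?_)
    · filter_upwards [(hG k).coeFn_toLp, h2] with X h4 h5
      rw [h4, h5]
    · congr 1
      refine integral_congr_ae ?_
      filter_upwards [hu.coeFn_toLp, h1] with X h4 h5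
      rw [h4, h5]
      simp [mul_comm]

end ProductModes

/-! ### Moment determinacy and the span of the even eigenfunctions. -/

section Moments

variable {N : ℕ}

/-- The exponential is expanded into its series and integrated term by term; the series of absolute
values sums to `|H| e^{‖ξ‖‖X‖}`, which is integrable. -/
lemma integral_mul_cexp_eq_zero {H : Space N → ℝ}
    (hH : ∀ c : ℝ, Integrable fun X => H X * Real.exp (c * ‖X‖))
    (hmom : ∀ (ξ : Space N) (n : ℕ), ∫ X, H X * inner ℝ X ξ ^ n = 0) (ξ : Space N) :
    ∫ X, (H X : ℂ) * Complex.exp (inner ℝ X ξ * Complex.I) = 0 := by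
  have hm : AEStronglyMeasurable H := by simpa using (hH 0).aestronglyMeasurable
  set F : ℕ → Space N → ℂ := fun n X =>
    (H X : ℂ) * ((inner ℝ X ξ * Complex.I) ^ n / (n.factorial : ℂ)) with hF
  set b : ℕ → Space N → ℝ := fun n X => |H X| * ((‖ξ‖ * ‖X‖) ^ n / n.factorial) with hb
  have hbs : ∀ X, HasSum (fun n => b n X) (|H X| * Real.exp (‖ξ‖ * ‖X‖)) := fun X => by
    have h := (NormedSpace.expSeries_div_hasSum_exp (‖ξ‖ * ‖X‖)).mul_left |H X|
    rwa [← Real.exp_eq_exp_ℝ] at h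
  have h := hasSum_integral_of_dominated_convergence (F := F) b (μ := volume)
    (f := fun X => (H X : ℂ) * Complex.exp (inner ℝ X ξ * Complex.I)) ?_ ?_ ?_ ?_ ?_
  · have h0 : ∀ n, ∫ X, F n X = 0 := fun n => by
      have h1 : F n = fun X => (((H X * inner ℝ X ξ ^ n : ℝ) : ℂ)) *
          (Complex.I ^ n / (n.factorial : ℂ)) := by
        funext X
        simp only [hF]
        push_cast
        ring
      rw [h1, integral_mul_const, integral_complex_ofReal, hmom]
      simp
    simp only [h0] at h
    exact h.unique hasSum_zero
  · intro n
    exact (Complex.continuous_ofReal.comp_aestronglyMeasurable hm).mul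
      (Continuous.aestronglyMeasurable (by fun_prop))
  · refine fun n => Filter.Eventually.of_forall fun X => ?_
    simp only [hF, hb, norm_mul, norm_div, norm_pow, Complex.norm_I, mul_one, Complex.norm_real,
      Complex.norm_natCast]
    have h1 := norm_inner_le_norm (𝕜 := ℝ) X ξ
    rw [mul_comm] at h1
    rw [Real.norm_eq_abs]
    gcongr
  · exact Filter.Eventually.of_forall fun X => (hbs X).summable
  · have h1 : (fun X => ∑' n, b n X) = fun X => ‖H X * Real.exp (‖ξ‖ * ‖X‖)‖ := by
      funext X
      rw [(hbs X).tsum_eq, norm_mul, Real.norm_eq_abs, Real.norm_of_nonneg (Real.exp_pos _).le]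
    rw [h1]
    exact (hH ‖ξ‖).norm
  · refine Filter.Eventually.of_forall fun X => ?_
    have h1 := (NormedSpace.expSeries_div_hasSum_exp
      (inner ℝ X ξ * Complex.I : ℂ)).mul_left (H X : ℂ)
    rwa [← Complex.exp_eq_exp_ℂ] at h1

/-- The positive and negative parts of `H` are densities of finite measures. Their characteristic
functions differ by the Fourier integral of `H`, which is zero, so the measures and then the
densities agree. -/
theorem ae_eq_zero_of_moments {H : Space N → ℝ}
    (hH : ∀ c : ℝ, Integrable fun X => H X * Real.exp (c * ‖X‖))
    (hmom : ∀ (ξ : Space N) (n : ℕ), ∫ X, H X * inner ℝ X ξ ^ n = 0) :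
    ∀ᵐ X, H X = 0 := by
  have hi : Integrable H := by simpa using hH 0
  have hm := hi.aestronglyMeasurable.aemeasurable
  have hm' : AEMeasurable fun X => -H X := hm.neg
  have fin1 : IsFiniteMeasure (volume.withDensity fun X => ENNReal.ofReal (H X)) :=
    isFiniteMeasure_withDensity_ofReal hi.2
  have fin2 : IsFiniteMeasure (volume.withDensity fun X => ENNReal.ofReal (-H X)) :=
    isFiniteMeasure_withDensity_ofReal hi.neg.2
  have heq : (volume.withDensity fun X => ENNReal.ofReal (H X))
      = volume.withDensity fun X => ENNReal.ofReal (-H X) := by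
    refine Measure.ext_of_charFun (funext fun ξ => ?_)
    rw [charFun_apply, charFun_apply,
      integral_withDensity_eq_integral_toReal_smul₀ hm.ennreal_ofReal (by simp),
      integral_withDensity_eq_integral_toReal_smul₀ hm'.ennreal_ofReal (by simp),
      ← sub_eq_zero]
    have hbd : ∀ G : Space N → ℝ, Integrable G →
        Integrable fun X => (ENNReal.ofReal (G X)).toReal • Complex.exp (inner ℝ X ξ * Complex.I) := by
      intro G hG
      have h1 : Integrable fun X => ((ENNReal.ofReal (G X)).toReal : ℂ) :=
        (hG.real_toNNReal).ofReal
      refine (h1.mul_bdd (c := 1) (g := fun X => Complex.exp (inner ℝ X ξ * Complex.I))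
        (Continuous.aestronglyMeasurable (by fun_prop))
        (Filter.Eventually.of_forall fun X => by
          rw [Complex.norm_exp_ofReal_mul_I])).congr (Filter.Eventually.of_forall fun X => ?_)
      simp
    rw [← integral_sub (hbd H hi) (hbd (fun X => -H X) hi.neg), ← integral_mul_cexp_eq_zero hH hmom ξ]
    refine integral_congr_ae (Filter.Eventually.of_forall fun X => ?_)
    simp only [ENNReal.toReal_ofReal', Complex.real_smul]
    rcases le_total (H X) 0 with h | h
    · rw [max_eq_right h, max_eq_left (by linarith)]; push_cast; ring
    · rw [max_eq_left h, max_eq_right (by linarith)]; push_cast; ring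
  have h2 := (withDensity_eq_iff_of_sigmaFinite hm.ennreal_ofReal hm'.ennreal_ofReal).mp heq
  filter_upwards [h2] with X hX
  have h3 := congrArg ENNReal.toReal hX
  simp only [ENNReal.toReal_ofReal'] at h3
  rcases le_total (H X) 0 with h | h
  · rw [max_eq_right h, max_eq_left (by linarith)] at h3; linarith
  · rw [max_eq_left h, max_eq_right (by linarith)] at h3; linarith

/-- The reflection in the hyperplane `{y = 0}`. -/
def flip (N : ℕ) : Space N ≃ₗᵢ[ℝ] Space N :=
  LinearIsometryEquiv.piLpCongrRight 2 fun k : Fin (N + 1) =>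
    if k = Fin.last N then LinearIsometryEquiv.neg ℝ else LinearIsometryEquiv.refl ℝ ℝ

lemma flip_last (X : Space N) : flip N X (Fin.last N) = -X (Fin.last N) := by
  simp [flip]

lemma flip_castSucc (X : Space N) (i : Fin N) : flip N X i.castSucc = X i.castSucc := by
  simp [flip, (Fin.castSucc_lt_last i).ne]

lemma flip_flip (X : Space N) : flip N (flip N X) = X := by
  ext k
  refine Fin.lastCases ?_ (fun i => ?_) k
  · rw [flip_last, flip_last, neg_neg]
  · rw [flip_castSucc, flip_castSucc]

lemma measurePreserving_flip : MeasurePreserving (flip N) := (flip N).measurePreserving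

/-- The span of the functions `H_α(x) L_{(s),m}(y²/4)`, `s = (b-1)/2`. -/
def evenSpan (N : ℕ) (b : ℝ) : Submodule ℝ (Space N → ℝ) :=
  Submodule.span ℝ (Set.range (eigenN b))

open Polynomial in
/-- The Laguerre polynomials as a sequence with one polynomial in each degree. -/
def laguerreSeq (s : ℝ) : Polynomial.Sequence ℝ := ⟨laguerrePoly s, degree_laguerrePoly s⟩

lemma span_laguerrePoly (s : ℝ) : Submodule.span ℝ (Set.range (laguerrePoly s)) = ⊤ :=
  (laguerreSeq s).span fun i => isUnit_iff_ne_zero.mpr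
    (Polynomial.leadingCoeff_ne_zero.mpr ((laguerreSeq s).ne_zero i))

/-- There is one Laguerre polynomial in each degree, so they span all polynomials in `y²/4`, and `Q`
may be taken to be one of them. -/
lemma hermiteMulti_mul_eval_mem (b : ℝ) (α : Fin N → ℕ) (Q : Polynomial ℝ) :
    (fun X : Space N => hermiteMulti α X * Q.eval (yCoord X ^ 2 / 4)) ∈ evenSpan N b := by
  have hQ : Q ∈ Submodule.span ℝ (Set.range (laguerrePoly ((b - 1) / 2))) := by
    rw [span_laguerrePoly]; exact Submodule.mem_top
  induction hQ using Submodule.span_induction with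
  | mem P hP =>
    obtain ⟨m, rfl⟩ := hP
    refine Submodule.subset_span ⟨(α, m), ?_⟩
    funext X
    rw [eigenN, laguerre_eq_eval]
  | zero =>
    exact (congrArg (· ∈ evenSpan N b) (funext fun X => by simp)).mp (evenSpan N b).zero_mem
  | add P Q _ _ hP hQ =>
    refine (congrArg (· ∈ evenSpan N b) (funext fun X => ?_)).mp ((evenSpan N b).add_mem hP hQ)
    simp only [Pi.add_apply, Polynomial.eval_add]
    ring
  | smul r P _ hP =>
    refine (congrArg (· ∈ evenSpan N b) (funext fun X => ?_)).mp ((evenSpan N b).smul_mem r hP)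
    simp only [Pi.smul_apply, Polynomial.eval_smul, smul_eq_mul]
    ring

lemma one_mem_evenSpan (b : ℝ) : (fun _ => 1 : Space N → ℝ) ∈ evenSpan N b := by
  have h := hermiteMulti_mul_eval_mem (N := N) b (fun _ => 0) 1
  simpa [hermiteMulti, hermite_eq_eval, hermitePoly] using h

lemma sq_yCoord_mul_mem_evenSpan {b : ℝ} {P : Space N → ℝ} (hP : P ∈ evenSpan N b) :
    (fun X => yCoord X ^ 2 * P X) ∈ evenSpan N b := by
  induction hP using Submodule.span_induction with
  | mem P hP =>
    obtain ⟨⟨α, m⟩, rfl⟩ := hP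
    have h := hermiteMulti_mul_eval_mem (N := N) b α
      (4 * Polynomial.X * laguerrePoly ((b - 1) / 2) m)
    refine (congrArg (· ∈ evenSpan N b) (funext fun X => ?_)).mp h
    simp only [eigenN, laguerre_eq_eval, Polynomial.eval_mul, Polynomial.eval_X,
      Polynomial.eval_ofNat]
    ring
  | zero =>
    exact (congrArg (· ∈ evenSpan N b) (funext fun X => by simp)).mp (evenSpan N b).zero_mem
  | add P Q _ _ hP hQ =>
    refine (congrArg (· ∈ evenSpan N b) (funext fun X => ?_)).mp ((evenSpan N b).add_mem hP hQ)
    simp only [Pi.add_apply]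
    ring
  | smul r P _ hP =>
    refine (congrArg (· ∈ evenSpan N b) (funext fun X => ?_)).mp ((evenSpan N b).smul_mem r hP)
    simp only [Pi.smul_apply, smul_eq_mul]
    ring

lemma hermiteMulti_update (α : Fin N → ℕ) (i : Fin N) (n : ℕ) (X : Space N) :
    hermiteMulti (Function.update α i n) X
      = hermite n (xCoord X i) * ∏ j ∈ Finset.univ.erase i, hermite (α j) (xCoord X j) := by
  rw [hermiteMulti, ← Finset.mul_prod_erase _ _ (Finset.mem_univ i), Function.update_self]
  congr 1
  exact Finset.prod_congr rfl fun j hj => by rw [Function.update_of_ne (Finset.ne_of_mem_erase hj)]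

lemma xCoord_mul_mem_evenSpan {b : ℝ} {P : Space N → ℝ} (hP : P ∈ evenSpan N b) (i : Fin N) :
    (fun X => xCoord X i * P X) ∈ evenSpan N b := by
  induction hP using Submodule.span_induction with
  | mem P hP =>
    obtain ⟨⟨α, m⟩, rfl⟩ := hP
    have h1 : eigenN b (Function.update α i (α i + 1), m) ∈ evenSpan N b :=
      Submodule.subset_span ⟨_, rfl⟩
    -- For `α i = 0` the truncated subtraction returns `0`, but this term then enters with
    -- coefficient `2 * α i = 0`.
    have h2 : eigenN b (Function.update α i (α i - 1), m) ∈ evenSpan N b :=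
      Submodule.subset_span ⟨_, rfl⟩
    refine (congrArg (· ∈ evenSpan N b) (funext fun X => ?_)).mp
      ((evenSpan N b).add_mem h1 ((evenSpan N b).smul_mem (2 * (α i : ℝ)) h2))
    have h3 := congrArg (Polynomial.eval (xCoord X i)) (X_mul_hermitePoly (α i))
    simp only [Polynomial.eval_mul, Polynomial.eval_add, Polynomial.eval_X, Polynomial.eval_ofNat,
      Polynomial.eval_natCast, ← hermite_eq_eval] at h3
    have h4 := hermiteMulti_update α i (α i) X
    rw [Function.update_eq_self] at h4
    simp only [Pi.add_apply, Pi.smul_apply, smul_eq_mul, eigenN, hermiteMulti_update, h4]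
    linear_combination (-(∏ j ∈ Finset.univ.erase i, hermite (α j) (xCoord X j))
      * laguerre ((b - 1) / 2) m (yCoord X ^ 2 / 4)) * h3
  | zero =>
    exact (congrArg (· ∈ evenSpan N b) (funext fun X => by simp)).mp (evenSpan N b).zero_mem
  | add P Q _ _ hP hQ =>
    refine (congrArg (· ∈ evenSpan N b) (funext fun X => ?_)).mp ((evenSpan N b).add_mem hP hQ)
    simp only [Pi.add_apply]
    ring
  | smul r P _ hP =>
    refine (congrArg (· ∈ evenSpan N b) (funext fun X => ?_)).mp ((evenSpan N b).smul_mem r hP)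
    simp only [Pi.smul_apply, smul_eq_mul]
    ring

/-- With `u` and `v` the contributions of `x` and `y` to the inner product, `p_n = (u+v)^n +
(u-v)^n` satisfies `p_{n+2} = 2u p_{n+1} + (v² - u²) p_n`. The span is stable under multiplication
by `u` and by `v²`, so induction works without a binomial expansion. -/
lemma inner_pow_add_inner_flip_pow_mem (b : ℝ) (ξ : Space N) (n : ℕ) :
    (fun X => inner ℝ X ξ ^ n + inner ℝ (flip N X) ξ ^ n) ∈ evenSpan N b := by
  set u : Space N → ℝ := fun X => ∑ i : Fin N, ξ i.castSucc * xCoord X i with hu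
  set v : Space N → ℝ := fun X => ξ (Fin.last N) * yCoord X with hv
  have h1 : ∀ X, inner ℝ X ξ = u X + v X := fun X => by
    rw [PiLp.inner_apply, Fin.sum_univ_castSucc]
    simp [hu, hv, xCoord, yCoord]
  have h2 : ∀ X, inner ℝ (flip N X) ξ = u X - v X := fun X => by
    rw [PiLp.inner_apply, Fin.sum_univ_castSucc]
    simp [hu, hv, xCoord, yCoord, flip_last, flip_castSucc, sub_eq_add_neg]
  have hmu : ∀ P ∈ evenSpan N b, (fun X => u X * P X) ∈ evenSpan N b := fun P hP => by
    have h := (evenSpan N b).sum_mem (t := Finset.univ) fun (i : Fin N) _ =>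
      (evenSpan N b).smul_mem (ξ i.castSucc) (xCoord_mul_mem_evenSpan hP i)
    refine (congrArg (· ∈ evenSpan N b) (funext fun X => ?_)).mp h
    simp only [Finset.sum_apply, Pi.smul_apply, smul_eq_mul, hu, Finset.sum_mul, mul_assoc]
  have hmv : ∀ P ∈ evenSpan N b, (fun X => v X ^ 2 * P X) ∈ evenSpan N b := fun P hP => by
    refine (congrArg (· ∈ evenSpan N b) (funext fun X => ?_)).mp
      ((evenSpan N b).smul_mem (ξ (Fin.last N) ^ 2) (sq_yCoord_mul_mem_evenSpan hP))
    simp only [Pi.smul_apply, smul_eq_mul, hv]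
    ring
  simp only [h2]
  simp only [h1]
  induction n using Nat.twoStepInduction with
  | zero =>
    refine (congrArg (· ∈ evenSpan N b) (funext fun X => ?_)).mp
      ((evenSpan N b).smul_mem 2 (one_mem_evenSpan b))
    simp only [Pi.smul_apply, smul_eq_mul]
    norm_num
  | one =>
    refine (congrArg (· ∈ evenSpan N b) (funext fun X => ?_)).mp
      ((evenSpan N b).smul_mem 2 (hmu _ (one_mem_evenSpan b)))
    simp only [Pi.smul_apply, smul_eq_mul]
    ring
  | more n ih1 ih2 =>
    refine (congrArg (· ∈ evenSpan N b) (funext fun X => ?_)).mp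
      ((evenSpan N b).add_mem ((evenSpan N b).smul_mem 2 (hmu _ ih2))
        ((evenSpan N b).sub_mem (hmv _ ih1) (hmu _ (hmu _ ih1))))
    simp only [Pi.smul_apply, Pi.add_apply, Pi.sub_apply, smul_eq_mul]
    ring

lemma exists_abs_eigenN_le_exp (b : ℝ) (p : Index N) :
    ∃ C c, 0 ≤ C ∧ ∀ X : Space N, |eigenN b p X| ≤ C * Real.exp (c * ‖X‖) := by
  have key : ∀ (P : Polynomial ℝ) (k : Fin (N + 1)), ∃ C, 0 ≤ C ∧ ∀ X : Space N,
      |P.eval (X k)| ≤ C * Real.exp ‖X‖ := fun P k => by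
    obtain ⟨C, hC⟩ := exists_abs_eval_le_exp P
    have hC0 : 0 ≤ C := by simpa using (abs_nonneg _).trans (hC 0)
    refine ⟨C, hC0, fun X => (hC _).trans ?_⟩
    have := PiLp.norm_apply_le X k
    rw [Real.norm_eq_abs] at this
    gcongr
  choose C hC0 hC using fun i : Fin N => key (hermitePoly (p.1 i)) i.castSucc
  obtain ⟨D, hD0, hD⟩ := key (quarterSq (laguerrePoly ((b - 1) / 2) p.2)) (Fin.last N)
  refine ⟨(∏ i, C i) * D, N + 1, mul_nonneg (Finset.prod_nonneg fun i _ => hC0 i) hD0, fun X => ?_⟩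
  rw [eigenN, abs_mul, hermiteMulti, Finset.abs_prod, add_mul, Real.exp_add, one_mul]
  have h1 : ∏ i, |hermite (p.1 i) (xCoord X i)| ≤ ∏ i, (C i * Real.exp ‖X‖) :=
    Finset.prod_le_prod (fun i _ => abs_nonneg _) fun i _ => by
      rw [hermite_eq_eval]; exact hC i X
  have h2 : |laguerre ((b - 1) / 2) p.2 (yCoord X ^ 2 / 4)| ≤ D * Real.exp ‖X‖ := by
    rw [laguerre_eq_eval, ← eval_quarterSq]; exact hD X
  rw [Finset.prod_mul_distrib, Finset.prod_const, Finset.card_univ, Fintype.card_fin,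
    ← Real.exp_nat_mul] at h1
  calc _ ≤ ((∏ i, C i) * Real.exp (N * ‖X‖)) * (D * Real.exp ‖X‖) := by
        gcongr
        exact mul_nonneg (Finset.prod_nonneg fun i _ => hC0 i) (Real.exp_pos _).le
    _ = _ := by ring

lemma continuous_eigenN (b : ℝ) (p : Index N) : Continuous (eigenN b p : Space N → ℝ) := by
  unfold eigenN hermiteMulti xCoord yCoord
  simp only [hermite_eq_eval, laguerre_eq_eval]
  fun_prop

lemma integrable_mul_of_exp_bound {H g : Space N → ℝ}
    (hH : ∀ c : ℝ, Integrable fun X => H X * Real.exp (c * ‖X‖)) (hg : Continuous g) {C c : ℝ}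
    (hgC : ∀ X, |g X| ≤ C * Real.exp (c * ‖X‖)) : Integrable fun X => H X * g X := by
  have hm : AEStronglyMeasurable H := by simpa using (hH 0).aestronglyMeasurable
  refine ((hH c).norm.const_mul C).mono' (hm.mul hg.aestronglyMeasurable)
    (Filter.Eventually.of_forall fun X => ?_)
  rw [norm_mul, norm_mul, Real.norm_eq_abs, Real.norm_eq_abs, Real.norm_of_nonneg (Real.exp_pos _).le]
  calc |H X| * |g X| ≤ |H X| * (C * Real.exp (c * ‖X‖)) := by gcongr; exact hgC X
    _ = _ := by ring

/-- A moment of `H + H ∘ flip` is the integral of `H` against the symmetrized power `⟨X, ξ⟩^n +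
⟨flip X, ξ⟩^n`. This lies in the span of the `eigenN b p`, so every moment vanishes. -/
theorem ae_add_flip_eq_zero {H : Space N → ℝ}
    (hH : ∀ c : ℝ, Integrable fun X => H X * Real.exp (c * ‖X‖)) (b : ℝ)
    (horth : ∀ p, ∫ X, H X * eigenN b p X = 0) : ∀ᵐ X, H X + H (flip N X) = 0 := by
  have hspan : ∀ P ∈ evenSpan N b, (Integrable fun X => H X * P X) ∧ ∫ X, H X * P X = 0 := by
    intro P hP
    induction hP using Submodule.span_induction with
    | mem P hP =>
      obtain ⟨p, rfl⟩ := hP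
      obtain ⟨C, c, -, hC⟩ := exists_abs_eigenN_le_exp b p
      exact ⟨integrable_mul_of_exp_bound hH (continuous_eigenN b p) hC, horth p⟩
    | zero => simp
    | add P Q _ _ hP hQ =>
      simp only [Pi.add_apply, mul_add]
      exact ⟨hP.1.add hQ.1, by rw [integral_add hP.1 hQ.1, hP.2, hQ.2, add_zero]⟩
    | smul r P _ hP =>
      simp only [Pi.smul_apply, smul_eq_mul, mul_left_comm _ r]
      exact ⟨hP.1.const_mul r, by rw [integral_const_mul, hP.2, mul_zero]⟩
  have hcomp : ∀ {g : Space N → ℝ}, Integrable g → Integrable fun X => g (flip N X) :=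
    fun hg => measurePreserving_flip.integrable_comp_of_integrable hg
  have hH' : ∀ c : ℝ, Integrable fun X => H (flip N X) * Real.exp (c * ‖X‖) := fun c => by
    simpa using hcomp (hH c)
  refine ae_eq_zero_of_moments (fun c => ?_) fun ξ n => ?_
  · refine ((hH c).add (hH' c)).congr (Filter.Eventually.of_forall fun X => ?_)
    simp only [Pi.add_apply]
    ring
  · have hg : Continuous fun X : Space N => inner ℝ X ξ ^ n := by fun_prop
    have hgC : ∀ X : Space N, |inner ℝ X ξ ^ n| ≤ n.factorial * Real.exp (‖ξ‖ * ‖X‖) := fun X => by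
      have h := Real.pow_div_factorial_le_exp (‖ξ‖ * ‖X‖) (by positivity) n
      rw [div_le_iff₀ (by positivity)] at h
      rw [abs_pow]
      have h1 := abs_real_inner_le_norm X ξ
      rw [mul_comm] at h1
      calc |inner ℝ X ξ| ^ n ≤ (‖ξ‖ * ‖X‖) ^ n := by gcongr
        _ ≤ _ := by linarith
    have i1 := integrable_mul_of_exp_bound hH hg hgC
    have i2 := integrable_mul_of_exp_bound hH' hg hgC
    have i3 : Integrable fun X => H X * inner ℝ (flip N X) ξ ^ n := by
      simpa [flip_flip] using hcomp i2
    have h1 : ∫ X, H (flip N X) * inner ℝ X ξ ^ n = ∫ X, H X * inner ℝ (flip N X) ξ ^ n := by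
      rw [← measurePreserving_flip.integral_comp (flip N).toHomeomorph.measurableEmbedding
        (fun X => H X * inner ℝ (flip N X) ξ ^ n)]
      simp only [flip_flip]
    simp only [add_mul]
    rw [integral_add i1 i2, h1, ← integral_add i1 i3]
    simp only [← mul_add]
    exact (hspan _ (inner_pow_add_inner_flip_pow_mem b ξ n)).2

end Moments

/-! ### The concrete measures and eigenfunctions as instances of the product theory. -/

section Concrete

variable {N : ℕ}

/-- A function for each coordinate, with a distinguished last one. -/
def withLast {β : Type*} (u : Fin N → β) (ρ : β) : Fin (N + 1) → β := Fin.snoc (α := fun _ => β) u ρ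

@[simp] lemma withLast_castSucc {β : Type*} (u : Fin N → β) (ρ : β) (i : Fin N) :
    withLast u ρ i.castSucc = u i := Fin.snoc_castSucc (α := fun _ => β) ρ u i

@[simp] lemma withLast_last {β : Type*} (u : Fin N → β) (ρ : β) :
    withLast u ρ (Fin.last N) = ρ := Fin.snoc_last (α := fun _ => β) ρ u

lemma prodFun_withLast (u : Fin N → ℝ → ℝ) (ρ : ℝ → ℝ) (X : Space N) :
    prodFun (withLast u ρ) X = (∏ i, u i (xCoord X i)) * ρ (yCoord X) := by
  simp [prodFun, Fin.prod_univ_castSucc, xCoord, yCoord]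

/-- The one-dimensional weights whose product is `|y|^a e^{-|X|²/4}`, restricted to `y ∈ A`. -/
def weights (N : ℕ) (A : Set ℝ) (a : ℝ) : Fin (N + 1) → ℝ → ℝ :=
  withLast (fun _ => gaussWeight) (lastWeight A a)

lemma measurable_lastWeight {A : Set ℝ} (hA : IsRange A) (a : ℝ) : Measurable (lastWeight A a) := by
  have := hA.measurable_chi
  have := continuous_gaussWeight
  unfold lastWeight
  fun_prop

lemma measurable_weights {A : Set ℝ} (hA : IsRange A) (a : ℝ) (k : Fin (N + 1)) :
    Measurable (weights N A a k) := by
  refine Fin.lastCases ?_ (fun i => ?_) k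
  · simpa [weights] using measurable_lastWeight hA a
  · simpa [weights] using continuous_gaussWeight.measurable

lemma weights_nonneg (A : Set ℝ) (a : ℝ) (k : Fin (N + 1)) (x : ℝ) : 0 ≤ weights N A a k x := by
  refine Fin.lastCases ?_ (fun i => ?_) k
  · simpa [weights] using lastWeight_nonneg A a x
  · simpa [weights] using (gaussWeight_pos x).le

/-- The measure with density `c |y|^a e^{-|X|²/4}` on `{y ∈ A}`. -/
abbrev muOn (N : ℕ) (c : ℝ) (A : Set ℝ) (a : ℝ) : Measure (Space N) := muProd c (weights N A a)

lemma prodFun_weights (A : Set ℝ) (a : ℝ) (X : Space N) :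
    prodFun (weights N A a) X
      = chi A (yCoord X) * (|yCoord X| ^ a * Real.exp (-‖X‖ ^ 2 / 4)) := by
  have h : -‖X‖ ^ 2 / 4 = (∑ i : Fin N, -(xCoord X i) ^ 2 / 4) + -(yCoord X) ^ 2 / 4 := by
    rw [EuclideanSpace.real_norm_sq_eq, Fin.sum_univ_castSucc, ← Finset.sum_div,
      Finset.sum_neg_distrib]
    simp only [xCoord, yCoord]
    ring
  rw [weights, prodFun_withLast, h, Real.exp_add, Real.exp_sum]
  simp only [gaussWeight, lastWeight]
  ring

/-- The normalizing constant of the fundamental solution. -/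
def normConst (N : ℕ) (a : ℝ) : ℝ :=
  1 / ((2 : ℝ) ^ a * Real.Gamma ((1 + a) / 2) * (4 * Real.pi) ^ ((N : ℝ) / 2))

lemma normConst_pos {a : ℝ} (ha : -1 < a) : 0 < normConst N a := by
  have := Real.Gamma_pos_of_pos (s := (1 + a) / 2) (by linarith)
  have := Real.pi_pos
  unfold normConst
  positivity

lemma isOpen_upperHalf : IsOpen (upperHalf N) :=
  isOpen_lt continuous_const contDiff_yCoord.continuous

lemma muHalf_eq (a : ℝ) : muHalf N a = muOn N (normConst N a) (Set.Ioi 0) a := by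
  rw [muHalf, ← withDensity_indicator isOpen_upperHalf.measurableSet, muOn, muProd]
  congr 1
  funext X
  rw [prodFun_weights]
  by_cases h : 0 < yCoord X
  · have h' : X ∈ upperHalf N := h
    rw [Set.indicator_of_mem h', chi_of_mem (Set.mem_Ioi.mpr h), abs_of_pos h, fundSol, normConst]
    congr 1
    ring
  · have h' : X ∉ upperHalf N := h
    rw [Set.indicator_of_notMem h', chi_of_notMem (by simpa using h)]
    simp

lemma muWhole_eq (a : ℝ) : muWhole N a = muOn N (normConst N a / 2) Set.univ a := by
  rw [muWhole, muOn, muProd]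
  congr 1
  funext X
  rw [prodFun_weights, chi_of_mem (Set.mem_univ _), fundSol, normConst]
  congr 1
  ring

/-! ### The eigenfunctions as modes -/

/-- The last factor of the odd and of the Dirichlet eigenfunctions, for the index `0`. -/
def oddFactor (A : Set ℝ) (a : ℝ) (y : ℝ) : ℝ := chi A y * (y * |y| ^ (-a))

/-- The eigenfunctions of odd type, restricted to `y ∈ A`. -/
def eigenOddOn (A : Set ℝ) (a : ℝ) (p : Index N) (X : Space N) : ℝ :=
  oddFactor A a (yCoord X) * eigenN (2 - a) p X

/-- The separated eigenvalues of `eigenN`. -/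
def lamN (p : Index N) : Fin (N + 1) → ℝ := withLast (fun i => (p.1 i : ℝ) / 2) (p.2 : ℝ)

/-- The separated eigenvalues of `eigenD` and `eigenOdd`. -/
def lamD (a : ℝ) (p : Index N) : Fin (N + 1) → ℝ :=
  withLast (fun i => (p.1 i : ℝ) / 2) ((p.2 : ℝ) + (1 - a) / 2)

lemma sum_lamN (p : Index N) : ∑ k, lamN p k = kappaN (∑ i, p.1 i) p.2 := by
  simp [lamN, kappaN, Fin.sum_univ_castSucc, Finset.sum_div]

lemma sum_lamD (a : ℝ) (p : Index N) : ∑ k, lamD a p k = kappaD a (∑ i, p.1 i) p.2 := by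
  simp [lamD, kappaD, Fin.sum_univ_castSucc, Finset.sum_div, add_assoc]

lemma eq_of_withLast_eq {α β : Fin N → ℕ} {s t : ℝ}
    (h : withLast (fun i => (α i : ℝ) / 2) s = withLast (fun i => (β i : ℝ) / 2) t) :
    α = β ∧ s = t := by
  refine ⟨funext fun i => ?_, by simpa using congrFun h (Fin.last N)⟩
  have := congrFun h i.castSucc
  simp only [withLast_castSucc] at this
  have h2 : (α i : ℝ) = β i := by linarith
  exact_mod_cast h2

lemma injective_lamN : Function.Injective (lamN : Index N → _) := fun p q h => by
  obtain ⟨h1, h2⟩ := eq_of_withLast_eq h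
  exact Prod.ext h1 (by exact_mod_cast h2)

lemma injective_lamD (a : ℝ) : Function.Injective (lamD a : Index N → _) := fun p q h => by
  obtain ⟨h1, h2⟩ := eq_of_withLast_eq h
  exact Prod.ext h1 (by exact_mod_cast add_right_cancel h2)

/-- The last entries are `m` and `m' + (1-a)/2` with `(1-a)/2` strictly between `0` and `1`, hence
never equal. This separates even from odd modes also for `a = 0`, where the total eigenvalues can
coincide. -/
lemma lamN_ne_lamD {a : ℝ} (ha : a ∈ Set.Ioo (-1 : ℝ) 1) (p q : Index N) : lamN p ≠ lamD a q := by
  intro h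
  obtain ⟨-, h2⟩ := eq_of_withLast_eq h
  have h3 : (q.2 : ℝ) < p.2 := by linarith [ha.2]
  have h4 : (p.2 : ℝ) < q.2 + 1 := by linarith [ha.1]
  have h5 : q.2 < p.2 := by exact_mod_cast h3
  have h6 : p.2 < q.2 + 1 := by exact_mod_cast h4
  omega

lemma eigenN_eq_prodFun (a : ℝ) (p : Index N) : (eigenN a p : Space N → ℝ)
    = prodFun (withLast (fun i => hermite (p.1 i))
        fun y => laguerre ((a - 1) / 2) p.2 (y ^ 2 / 4)) := by
  funext X
  rw [prodFun_withLast, eigenN, hermiteMulti]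

/-- Replacing `a` by `2 - a` in the even family gives the Laguerre order `(1-a)/2`. An odd mode is
thus `y|y|^{-a}` times an even-type function, which lets one moment argument serve both families. -/
lemma eigenOddOn_eq_prodFun (A : Set ℝ) (a : ℝ) (p : Index N) : (eigenOddOn A a p : Space N → ℝ)
    = prodFun (withLast (fun i => hermite (p.1 i))
        fun y => chi A y * ((y * |y| ^ (-a)) * laguerre ((1 - a) / 2) p.2 (y ^ 2 / 4))) := by
  funext X
  rw [prodFun_withLast, eigenOddOn, eigenN, hermiteMulti, oddFactor,
    show (2 - a - 1) / 2 = (1 - a) / 2 by ring]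
  ring

lemma factor_withLast {A : Set ℝ} {a : ℝ} (α : Fin N → ℕ) {ρ d f : ℝ → ℝ} {lam : ℝ}
    (h : Factor (lastWeight A a) ρ d f lam) (k : Fin (N + 1)) :
    Factor (weights N A a k) (withLast (fun i => hermite (α i)) ρ k)
      (withLast (fun i x => (hermitePoly (α i)).derivative.eval x) d k)
      (withLast (fun i x => (hermitePoly (α i)).derivative.eval x * gaussWeight x) f k)
      (withLast (fun i => (α i : ℝ) / 2) lam k) := by
  refine Fin.lastCases ?_ (fun i => ?_) k
  · simpa [weights] using h
  · simpa [weights] using factor_hermite (α i)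

lemma continuousAt_flux {U : Set (Space N)} (α : Fin N → ℕ) {f : ℝ → ℝ}
    (hf : ∀ X ∈ U, ContinuousAt f (yCoord X)) (k : Fin (N + 1)) (X : Space N) (hX : X ∈ U) :
    ContinuousAt (withLast (fun i x => (hermitePoly (α i)).derivative.eval x * gaussWeight x) f k)
      (X k) := by
  refine Fin.lastCases ?_ (fun i => ?_) k
  · simp only [withLast_last]
    exact hf X hX
  · simp only [withLast_castSucc]
    have := continuous_gaussWeight
    exact Continuous.continuousAt (by fun_prop)

lemma contDiff_hermite (n : ℕ) : ContDiff ℝ ∞ (hermite n) := by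
  have : hermite n = fun x => (hermitePoly n).eval x := funext (hermite_eq_eval n)
  rw [this]
  simpa only [Polynomial.coe_aeval_eq_eval] using (hermitePoly n).contDiff_aeval (𝕜 := ℝ) ∞

lemma contDiff_laguerre_sq (s : ℝ) (m : ℕ) : ContDiff ℝ ∞ fun y => laguerre s m (y ^ 2 / 4) := by
  have : (fun y => laguerre s m (y ^ 2 / 4)) = fun y => (quarterSq (laguerrePoly s m)).eval y := by
    funext y
    rw [laguerre_eq_eval, eval_quarterSq]
  rw [this]
  simpa only [Polynomial.coe_aeval_eq_eval] using
    (quarterSq (laguerrePoly s m)).contDiff_aeval (𝕜 := ℝ) ∞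

variable {c a : ℝ} {A : Set ℝ}

lemma memLp_eigenN (hc : 0 < c) (hA : IsRange A) (ha : -1 < a) (p : Index N) :
    MemLp (eigenN a p) 2 (muOn N c A a) := by
  rw [eigenN_eq_prodFun]
  exact memLp_prodFun_of_factor hc (measurable_weights hA a) (weights_nonneg A a)
    (factor_withLast p.1 (factor_even hA ha p.2))

theorem isMode_eigenN (hc : 0 < c) (hA : IsRange A) (ha : -1 < a) (p : Index N)
    (h : MemLp (eigenN a p) 2 (muOn N c A a)) :
    IsMode (muOn N c A a) Set.univ h.toLp (lamN p) := by
  revert h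
  rw [eigenN_eq_prodFun]
  intro h
  refine isMode_prodFun hc (measurable_weights hA a) (weights_nonneg A a)
    (factor_withLast p.1 (factor_even hA ha p.2)) (continuousAt_flux p.1 fun X _ =>
      (continuous_chi_mul hA (continuous_flux_even ha _) (by simp)).continuousAt) h
    fun hg hgrad => mem_sobolev_of_contDiff h hg hgrad (contDiff_iff_contDiffAt.mpr fun X =>
      contDiffAt_prodFun fun k => ?_)
  refine Fin.lastCases ?_ (fun i => ?_) k
  · simpa using (contDiff_laguerre_sq _ _).contDiffAt
  · simpa using (contDiff_hermite _).contDiffAt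

lemma memLp_eigenOddOn (hc : 0 < c) (hA : IsRange A) (ha : a < 1) (p : Index N) :
    MemLp (eigenOddOn A a p) 2 (muOn N c A a) := by
  rw [eigenOddOn_eq_prodFun]
  exact memLp_prodFun_of_factor hc (measurable_weights hA a) (weights_nonneg A a)
    (factor_withLast p.1 (factor_odd hA ha p.2))

/-- Near `y = 0` the square of `|y|⁻¹ y|y|^{-a}` times the weight `|y|^a` is of order `|y|^{-a}`,
integrable because `a < 1`. -/
lemma memLp_inv_mul_eigenOddOn (hc : 0 < c) (hA : IsRange A) (ha : a < 1) (p : Index N) :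
    MemLp (fun X => |yCoord X|⁻¹ * eigenOddOn A a p X) 2 (muOn N c A a) := by
  set L := laguerrePoly ((1 - a) / 2) p.2 with hL
  set ρ : ℝ → ℝ := fun y => |y|⁻¹ * (chi A y * ((y * |y| ^ (-a)) * L.eval (y ^ 2 / 4))) with hρ
  have h1 : (fun X : Space N => |yCoord X|⁻¹ * eigenOddOn A a p X)
      = prodFun (withLast (fun i => hermite (p.1 i)) ρ) := by
    funext X
    rw [eigenOddOn_eq_prodFun, prodFun_withLast, prodFun_withLast]
    simp only [hρ, laguerre_eq_eval, hL]
    ring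
  have hχ := hA.measurable_chi
  rw [h1]
  refine memLp_prodFun hc (measurable_weights hA a) (weights_nonneg A a) (fun k => ?_) fun k => ?_
  · refine Fin.lastCases ?_ (fun i => ?_) k
    · simp only [withLast_last, hρ]
      fun_prop
    · simpa using (contDiff_hermite (p.1 i)).continuous.measurable
  · refine Fin.lastCases ?_ (fun i => ?_) k
    · refine (integrable_lastWeight_mul hA (b := -a) (by linarith) (quarterSq L ^ 2)).congr
        (ae_ne_zero.mono fun y hy => ?_)
      have h2 := abs_rpow_neg_mul (a := a) hy
      have h3 : (|y|⁻¹ * y) ^ 2 = 1 := by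
        rw [mul_pow, inv_pow, sq_abs, inv_mul_cancel₀ (pow_ne_zero 2 hy)]
      have h4 := chi_mul_self A y
      simp only [weights, withLast_last, Polynomial.eval_pow, eval_quarterSq, lastWeight, hρ]
      calc L.eval (y ^ 2 / 4) ^ 2 * (chi A y * (|y| ^ (-a) * gaussWeight y))
          = 1 * L.eval (y ^ 2 / 4) ^ 2 * (chi A y * (|y| ^ (-a) * 1 * gaussWeight y)) := by ring
        _ = (|y|⁻¹ * y) ^ 2 * L.eval (y ^ 2 / 4) ^ 2 * (chi A y * chi A y * chi A y
              * (|y| ^ (-a) * (|y| ^ (-a) * |y| ^ a) * gaussWeight y)) := by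
            rw [h2, h3, h4, h4]
        _ = _ := by ring
    · simpa [weights] using (factor_hermite (p.1 i)).integrable_sq

/-- The admissible pairs of a range `A` of the last coordinate and a domain `U` for the problems
whose eigenfunctions are of odd type. -/
def IsOddPair (A : Set ℝ) (U : Set (Space N)) : Prop :=
  (A = Set.univ ∧ U = Set.univ) ∨ (A = Set.Ioi 0 ∧ U = upperHalf N)

lemma IsOddPair.isRange {U : Set (Space N)} (h : IsOddPair A U) : IsRange A :=
  h.imp And.left And.left

/-- The flux of odd type need not vanish at `0`. On the whole line there is no cutoff, and on the
half-space `U` stays away from the jump of `chi A`. -/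
lemma IsOddPair.continuousAt {U : Set (Space N)} (h : IsOddPair A U) {f : ℝ → ℝ}
    (hf : Continuous f) {X : Space N} (hX : X ∈ U) :
    ContinuousAt (fun y => chi A y * f y) (yCoord X) := by
  rcases h with ⟨rfl, rfl⟩ | ⟨rfl, rfl⟩
  · simpa [chi] using hf.continuousAt
  · have hX' : 0 < yCoord X := hX
    refine hf.continuousAt.congr ?_
    filter_upwards [Ioi_mem_nhds hX'] with y hy
    rw [chi_of_mem hy, one_mul]

lemma IsOddPair.mem_of_mem_tsupport {U : Set (Space N)} (h : IsOddPair A U) (p : Index N)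
    {X : Space N} (hX : X ∈ tsupport (eigenOddOn A a p)) (hy : yCoord X ≠ 0) : X ∈ U := by
  rcases h with ⟨rfl, rfl⟩ | ⟨rfl, rfl⟩
  · exact Set.mem_univ _
  · have hcl : IsClosed {X : Space N | 0 ≤ yCoord X} :=
      isClosed_le continuous_const contDiff_yCoord.continuous
    have hsub : Function.support (eigenOddOn (N := N) (Set.Ioi 0) a p)
        ⊆ {X : Space N | 0 ≤ yCoord X} := by
      intro Y hY
      by_contra hneg
      refine hY ?_
      have : yCoord Y ∉ Set.Ioi (0 : ℝ) := fun h => hneg (le_of_lt (Set.mem_Ioi.mp h) : 0 ≤ yCoord Y)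
      simp [eigenOddOn, oddFactor, chi_of_notMem this]
    exact lt_of_le_of_ne (closure_minimal hsub hcl hX) hy.symm

theorem isMode_eigenOddOn (hc : 0 < c) {U : Set (Space N)} (hAU : IsOddPair A U) (ha : a < 1)
    (p : Index N) (h : MemLp (eigenOddOn A a p) 2 (muOn N c A a)) :
    IsMode (muOn N c A a) U h.toLp (lamD a p) := by
  have hA := hAU.isRange
  have hsupp := fun X => hAU.mem_of_mem_tsupport (a := a) p (X := X)
  have hinv := memLp_inv_mul_eigenOddOn (N := N) hc hA ha p
  revert h
  rw [eigenOddOn_eq_prodFun] at hsupp hinv ⊢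
  intro h
  have hcg := continuous_gaussWeight
  refine isMode_prodFun hc (measurable_weights hA a) (weights_nonneg A a)
    (factor_withLast p.1 (factor_odd hA ha p.2)) (continuousAt_flux p.1 fun X hX =>
      hAU.continuousAt (by fun_prop) hX) h
    fun hg hgrad => mem_sobolev_of_contDiffAt h hg hgrad
      (ae_muProd_of_ae (ae_coord_ne_zero.mono fun X hX => hX _))
      (fun X hX => contDiffAt_prodFun fun k => ?_) hsupp hinv
  refine Fin.lastCases ?_ (fun i => ?_) k
  · simp only [withLast_last]
    have hX' : X (Fin.last N) ≠ 0 := hX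
    have h1 : ContDiffAt ℝ ∞ (fun y : ℝ => |y| ^ (-a)) (X (Fin.last N)) :=
      (contDiffAt_abs hX').rpow_const_of_ne (abs_ne_zero.mpr hX')
    have h2 : ContDiffAt ℝ ∞ (fun y : ℝ => chi A (X (Fin.last N)) * ((y * |y| ^ (-a))
        * laguerre ((1 - a) / 2) p.2 (y ^ 2 / 4))) (X (Fin.last N)) :=
      contDiffAt_const.mul ((contDiffAt_id.mul h1).mul (contDiff_laguerre_sq _ _).contDiffAt)
    exact h2.congr_of_eventuallyEq ((hA.eventually_chi_eq hX').mono fun y hy => by simp only [hy])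
  · simpa using (contDiff_hermite _).contDiffAt

end Concrete

/-! ### Totality of the eigenfunctions in `L²`. -/

section Completeness

variable {N : ℕ} {c a : ℝ} {A : Set ℝ}

lemma norm_le_sum_abs (X : Space N) : ‖X‖ ≤ ∑ k, |X k| := by
  have h := (EuclideanSpace.basisFun (Fin (N + 1)) ℝ).sum_repr X
  calc ‖X‖ = ‖∑ k, X k • EuclideanSpace.basisFun (Fin (N + 1)) ℝ k‖ := by
        congr 1
        exact h.symm
    _ ≤ ∑ k, ‖X k • EuclideanSpace.basisFun (Fin (N + 1)) ℝ k‖ := norm_sum_le _ _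
    _ = ∑ k, |X k| := by simp [norm_smul]

/-- By Cauchy–Schwarz in `L²(μ)` it suffices that `v(y)` times an exponential is square integrable.
The exponential of `|r| Σ |X_k|` is used because it dominates that of `r ‖X‖` and factors over the
coordinates. -/
lemma integrable_mul_exp_of_memLp (hc : 0 < c) (hA : IsRange A) {f : Space N → ℝ}
    (hf : MemLp f 2 (muOn N c A a)) {v : ℝ → ℝ} (hvm : Measurable v)
    (hv : ∀ r, Integrable fun y => (v y * Real.exp (r * |y|)) ^ 2 * lastWeight A a y) (r : ℝ) :
    Integrable fun X => f X * v (yCoord X) * prodFun (weights N A a) X * Real.exp (r * ‖X‖) := by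
  set g : Space N → ℝ := prodFun (withLast (fun _ x => Real.exp (|r| * |x|))
    fun y => v y * Real.exp (|r| * |y|)) with hg
  have hgL : MemLp g 2 (muOn N c A a) := by
    refine memLp_prodFun hc (measurable_weights hA a) (weights_nonneg A a) (fun k => ?_) fun k => ?_
    · refine Fin.lastCases ?_ (fun i => ?_) k
      · simp only [withLast_last]
        fun_prop
      · simp only [withLast_castSucc]
        fun_prop
    · refine Fin.lastCases ?_ (fun i => ?_) k
      · simpa [weights] using hv |r|
      · have h := integrable_chi_mul (A := Set.univ) (Or.inl rfl) (b := 0) (by norm_num) 1 (2 * |r|)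
        refine h.congr (Filter.Eventually.of_forall fun x => ?_)
        simp only [weights, withLast_castSucc, gaussWeight, chi_of_mem (Set.mem_univ x),
          Real.rpow_zero, Polynomial.eval_one]
        rw [show 2 * |r| * |x| = |r| * |x| + |r| * |x| by ring, Real.exp_add]
        ring
  have h1 : Integrable (fun X => f X * g X) (muOn N c A a) := hf.integrable_mul hgL
  rw [integrable_muProd_iff hc (measurable_weights hA a) (weights_nonneg A a)] at h1
  have hgX : ∀ X : Space N, g X = v (yCoord X) * Real.exp (|r| * ∑ k, |X k|) := fun X => by
    rw [hg, prodFun_withLast, ← Real.exp_sum, Fin.sum_univ_castSucc, mul_add, Real.exp_add,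
      Finset.mul_sum]
    simp only [xCoord, yCoord]
    ring
  refine (h1.mul_bdd (c := 1) (g := fun X => Real.exp (r * ‖X‖ - |r| * ∑ k, |X k|))
    (Continuous.aestronglyMeasurable (by fun_prop))
    (Filter.Eventually.of_forall fun X => ?_)).congr (Filter.Eventually.of_forall fun X => ?_)
  · rw [Real.norm_of_nonneg (Real.exp_pos _).le, Real.exp_le_one_iff, sub_nonpos]
    exact mul_le_mul (le_abs_self r) (norm_le_sum_abs X) (norm_nonneg _) (abs_nonneg _)
  · simp only [hgX, Real.exp_sub]
    have := (Real.exp_pos (|r| * ∑ k, |X k|)).ne'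
    field_simp

theorem ae_add_flip_eq_zero_of_orthogonal (hc : 0 < c) (hA : IsRange A) {f : Space N → ℝ}
    (hf : MemLp f 2 (muOn N c A a)) {v : ℝ → ℝ} (hvm : Measurable v)
    (hv : ∀ r, Integrable fun y => (v y * Real.exp (r * |y|)) ^ 2 * lastWeight A a y) (b : ℝ)
    (horth : ∀ p, ∫ X, (v (yCoord X) * eigenN b p X) * f X ∂muOn N c A a = 0) :
    ∀ᵐ X : Space N, f X * v (yCoord X) * prodFun (weights N A a) X
      + f (flip N X) * v (-yCoord X) * prodFun (weights N A a) (flip N X) = 0 := by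
  have h := ae_add_flip_eq_zero (integrable_mul_exp_of_memLp hc hA hf hvm hv) b fun p => by
    have h1 := horth p
    rw [integral_muProd hc.le (measurable_weights hA a) (weights_nonneg A a)] at h1
    rw [← (mul_eq_zero.mp h1).resolve_left hc.ne']
    refine integral_congr_ae (Filter.Eventually.of_forall fun X => ?_)
    simp only
    ring
  filter_upwards [h] with X hX
  rwa [show yCoord (flip N X) = -yCoord X from flip_last X] at hX

lemma integral_toLp_mul_eq_zero {μ : Measure (Space N)} {e : Space N → ℝ} (he : MemLp e 2 μ)
    {f : Lp ℝ 2 μ} (h : inner ℝ he.toLp f = 0) : ∫ X, e X * f X ∂μ = 0 := by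
  rw [← h, L2.inner_def]
  refine integral_congr_ae ?_
  filter_upwards [he.coeFn_toLp] with X hX
  rw [hX]
  simp [mul_comm]

theorem ae_add_flip_of_orthogonal_eigenN (hc : 0 < c) (hA : IsRange A) (ha : -1 < a)
    {f : Lp ℝ 2 (muOn N c A a)} (h : ∀ p, MemLp (eigenN a p) 2 (muOn N c A a))
    (horth : ∀ p, inner ℝ (h p).toLp f = 0) :
    ∀ᵐ X : Space N, f X * prodFun (weights N A a) X
      + f (flip N X) * prodFun (weights N A a) (flip N X) = 0 := by
  have h1 := ae_add_flip_eq_zero_of_orthogonal hc hA (Lp.memLp f) (v := fun _ => 1)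
    measurable_const (fun r => ?_) a fun p => ?_
  · simpa using h1
  · refine (integrable_chi_mul hA ha 1 (2 * r)).congr (Filter.Eventually.of_forall fun y => ?_)
    simp only [lastWeight, gaussWeight, Polynomial.eval_one]
    rw [show 2 * r * |y| = r * |y| + r * |y| by ring, Real.exp_add]
    ring
  · simpa using integral_toLp_mul_eq_zero (h p) (horth p)

lemma measurable_oddFactor (hA : IsRange A) : Measurable (oddFactor A a) := by
  have := hA.measurable_chi
  unfold oddFactor
  fun_prop

/-- The moment argument is applied with profile `v(y) = y|y|^{-a}` and with `b = 2 - a`. -/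
theorem ae_add_flip_of_orthogonal_eigenOddOn (hc : 0 < c) (hA : IsRange A) (ha : a < 1)
    {f : Lp ℝ 2 (muOn N c A a)} (h : ∀ p, MemLp (eigenOddOn A a p) 2 (muOn N c A a))
    (horth : ∀ p, inner ℝ (h p).toLp f = 0) :
    ∀ᵐ X : Space N, f X * oddFactor A a (yCoord X) * prodFun (weights N A a) X
      + f (flip N X) * oddFactor A a (-yCoord X) * prodFun (weights N A a) (flip N X) = 0 := by
  refine ae_add_flip_eq_zero_of_orthogonal hc hA (Lp.memLp f) (measurable_oddFactor hA)
    (fun r => ?_) (2 - a) fun p => integral_toLp_mul_eq_zero (h p) (horth p)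
  refine (integrable_chi_mul hA (b := -a) (by linarith) (Polynomial.X ^ 2) (2 * r)).congr
    (ae_ne_zero.mono fun y hy => ?_)
  have h2 := abs_rpow_neg_mul (a := a) hy
  have h4 := chi_mul_self A y
  simp only [lastWeight, gaussWeight, oddFactor, Polynomial.eval_pow, Polynomial.eval_X]
  rw [show 2 * r * |y| = r * |y| + r * |y| by ring, Real.exp_add]
  calc chi A y * (|y| ^ (-a) * (y ^ 2 * (Real.exp (r * |y|) * Real.exp (r * |y|)))
          * Real.exp (-y ^ 2 / 4))
      = chi A y * ((|y| ^ (-a) * 1) * (y ^ 2 * (Real.exp (r * |y|) * Real.exp (r * |y|)))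
          * Real.exp (-y ^ 2 / 4)) := by ring
    _ = chi A y * chi A y * chi A y * ((|y| ^ (-a) * (|y| ^ (-a) * |y| ^ a))
          * (y ^ 2 * (Real.exp (r * |y|) * Real.exp (r * |y|))) * Real.exp (-y ^ 2 / 4)) := by
        rw [h2, h4, h4]
    _ = _ := by ring

lemma prodFun_weights_pos {X : Space N} (hX : yCoord X ≠ 0) (hXA : yCoord X ∈ A) :
    0 < prodFun (weights N A a) X := by
  rw [prodFun_weights, chi_of_mem hXA]
  have := abs_pos.mpr hX
  positivity

lemma lp_eq_zero_of_ae (f : Lp ℝ 2 (muOn N c A a))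
    (h : ∀ᵐ X : Space N, yCoord X ≠ 0 → yCoord X ∈ A → f X = 0) (hA : IsRange A) : f = 0 := by
  rw [Lp.eq_zero_iff_ae_eq_zero]
  have hm := measurable_prodFun (measurable_weights (N := N) hA a)
  refine (ae_withDensity_iff (by fun_prop)).mpr ?_
  filter_upwards [h, ae_coord_ne_zero] with X hX hX0 hne
  refine hX (hX0 _) ?_
  by_contra hXA
  rw [prodFun_weights, chi_of_notMem hXA] at hne
  simp at hne

lemma yCoord_flip (X : Space N) : yCoord (flip N X) = -yCoord X := flip_last X

lemma oddFactor_ne_zero {y : ℝ} (hy : y ≠ 0) (hyA : y ∈ A) : oddFactor A a y ≠ 0 := by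
  rw [oddFactor, chi_of_mem hyA, one_mul]
  exact mul_ne_zero hy (Real.rpow_pos_of_pos (abs_pos.mpr hy) _).ne'

/-- At a point of the half-space the reflected term vanishes, since the weight is zero for `y < 0`;
what remains is `f` times a positive weight. -/
theorem eq_zero_of_orthogonal_eigenN_half (hc : 0 < c) (ha : -1 < a)
    (h : ∀ p, MemLp (eigenN a p) 2 (muOn N c (Set.Ioi 0) a)) (f : Lp ℝ 2 (muOn N c (Set.Ioi 0) a))
    (horth : ∀ p, inner ℝ (h p).toLp f = 0) : f = 0 := by
  refine lp_eq_zero_of_ae f ?_ (Or.inr rfl)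
  filter_upwards [ae_add_flip_of_orthogonal_eigenN hc (Or.inr rfl) ha h horth] with X hX h0 h1
  have h2 : prodFun (weights N (Set.Ioi 0) a) (flip N X) = 0 := by
    rw [prodFun_weights, yCoord_flip, chi_of_notMem (by simpa using le_of_lt (Set.mem_Ioi.mp h1)),
      zero_mul]
  rw [h2, mul_zero, add_zero] at hX
  exact (mul_eq_zero.mp hX).resolve_right (prodFun_weights_pos h0 h1).ne'

theorem eq_zero_of_orthogonal_eigenOddOn_half (hc : 0 < c) (ha : a < 1)
    (h : ∀ p, MemLp (eigenOddOn (Set.Ioi 0) a p) 2 (muOn N c (Set.Ioi 0) a))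
    (f : Lp ℝ 2 (muOn N c (Set.Ioi 0) a)) (horth : ∀ p, inner ℝ (h p).toLp f = 0) : f = 0 := by
  refine lp_eq_zero_of_ae f ?_ (Or.inr rfl)
  filter_upwards [ae_add_flip_of_orthogonal_eigenOddOn hc (Or.inr rfl) ha h horth] with X hX h0 h1
  have h2 : prodFun (weights N (Set.Ioi 0) a) (flip N X) = 0 := by
    rw [prodFun_weights, yCoord_flip, chi_of_notMem (by simpa using le_of_lt (Set.mem_Ioi.mp h1)),
      zero_mul]
  rw [h2, mul_zero, add_zero] at hX
  exact (mul_eq_zero.mp ((mul_eq_zero.mp hX).resolve_right (prodFun_weights_pos h0 h1).ne'))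
    |>.resolve_right (oddFactor_ne_zero h0 h1)

/-- The weight is even and `y|y|^{-a}` is odd, so the two families give `f + f ∘ flip = 0` and `f -
f ∘ flip = 0`. -/
theorem eq_zero_of_orthogonal_whole (hc : 0 < c) (ha : a ∈ Set.Ioo (-1 : ℝ) 1)
    (h : ∀ p, MemLp (eigenN a p) 2 (muOn N c Set.univ a))
    (h' : ∀ p, MemLp (eigenOddOn Set.univ a p) 2 (muOn N c Set.univ a))
    (f : Lp ℝ 2 (muOn N c Set.univ a)) (horth : ∀ p, inner ℝ (h p).toLp f = 0)
    (horth' : ∀ p, inner ℝ (h' p).toLp f = 0) : f = 0 := by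
  refine lp_eq_zero_of_ae f ?_ (Or.inl rfl)
  filter_upwards [ae_add_flip_of_orthogonal_eigenN hc (Or.inl rfl) ha.1 h horth,
    ae_add_flip_of_orthogonal_eigenOddOn hc (Or.inl rfl) ha.2 h' horth'] with X h1 h2 h3 h4
  have h5 : prodFun (weights N Set.univ a) (flip N X) = prodFun (weights N Set.univ a) X := by
    rw [prodFun_weights, prodFun_weights, yCoord_flip, abs_neg, LinearIsometryEquiv.norm_map]
    simp [chi]
  have h6 : oddFactor Set.univ a (-yCoord X) = -oddFactor Set.univ a (yCoord X) := by
    simp [oddFactor, chi]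
  rw [h5] at h1 h2
  rw [h6] at h2
  have hW := prodFun_weights_pos (a := a) h3 h4
  have hO := oddFactor_ne_zero (a := a) h3 h4
  have h7 : f X + f (flip N X) = 0 :=
    (mul_eq_zero.mp (by rw [add_mul]; exact h1)).resolve_right hW.ne'
  have h8 : f X - f (flip N X) = 0 := by
    have : (f X - f (flip N X)) * (oddFactor Set.univ a (yCoord X)
        * prodFun (weights N Set.univ a) X) = 0 := by rw [← h2]; ring
    exact (mul_eq_zero.mp this).resolve_right (mul_ne_zero hO hW.ne')
  linarith

/-! ### The eigenfunctions do not vanish identically -/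

lemma ae_eval_ne_zero {P : Polynomial ℝ} (hP : P ≠ 0) : ∀ᵐ x : ℝ, P.eval x ≠ 0 := by
  have h : {x : ℝ | P.eval x = 0}.Finite := by
    refine (P.roots.toFinset.finite_toSet).subset fun x hx => ?_
    simpa [hP] using hx
  have := h.measure_zero volume
  rw [ae_iff]
  simpa using this

/-- The map `y ↦ y²/4` attains every `r ≥ 0`, at `y = 2√r`, so a vanishing composition would give
`P` infinitely many roots. -/
lemma quarterSq_ne_zero {P : Polynomial ℝ} (hP : P ≠ 0) : quarterSq P ≠ 0 := by
  intro h
  refine hP (Polynomial.eq_zero_of_infinite_isRoot P ((Set.Ici_infinite (0 : ℝ)).mono fun r hr => ?_))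
  have h1 := eval_quarterSq P (2 * Real.sqrt r)
  rw [h, Polynomial.eval_zero, mul_pow, Real.sq_sqrt hr] at h1
  change P.eval r = 0
  rw [h1]
  congr 1
  ring

lemma ae_eigenN_ne_zero (b : ℝ) (p : Index N) : ∀ᵐ X : Space N, eigenN b p X ≠ 0 := by
  have hev : ∀ (k : Fin (N + 1)) {P : Polynomial ℝ}, P ≠ 0 → ∀ᵐ X : Space N, P.eval (X k) ≠ 0 :=
    fun k P hP => ((Measure.quasiMeasurePreserving_eval
      (μ := fun _ : Fin (N + 1) => (volume : Measure ℝ)) k).comp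
      (PiLp.volume_preserving_ofLp (Fin (N + 1))).quasiMeasurePreserving).ae (ae_eval_ne_zero hP)
  have hL : laguerrePoly ((b - 1) / 2) p.2 ≠ 0 := (laguerreSeq ((b - 1) / 2)).ne_zero p.2
  filter_upwards [ae_all_iff.mpr fun i : Fin N => hev i.castSucc (hermitePoly_ne_zero (p.1 i)),
    hev (Fin.last N) (quarterSq_ne_zero hL)] with X h1 h2
  refine mul_ne_zero (Finset.prod_ne_zero_iff.mpr fun i _ => ?_) ?_
  · rw [hermite_eq_eval]
    exact h1 i
  · rw [laguerre_eq_eval, ← eval_quarterSq]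
    exact h2

lemma volume_upperHalf_pos : 0 < volume (upperHalf N) :=
  isOpen_upperHalf.measure_pos _ ⟨EuclideanSpace.single (Fin.last N) 1, by
    simp [upperHalf, yCoord]⟩

lemma toLp_ne_zero_of_ae (hc : 0 < c) (hA : IsRange A) {e : Space N → ℝ}
    (he : MemLp e 2 (muOn N c A a)) (h : ∀ᵐ X : Space N, 0 < yCoord X → e X ≠ 0) :
    he.toLp ≠ 0 := by
  intro h0
  have h1 : e =ᵐ[muOn N c A a] 0 :=
    he.coeFn_toLp.symm.trans (by rw [h0]; exact Lp.coeFn_zero _ _ _)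
  have hm := measurable_prodFun (measurable_weights (N := N) hA a)
  rw [Filter.EventuallyEq, muOn, muProd, ae_withDensity_iff (by fun_prop)] at h1
  -- Both admissible ranges contain the open half-space, which has positive volume. The double
  -- negation matches the form that `ae_iff` gives to the exceptional set.
  refine volume_upperHalf_pos.ne' (measure_mono_null (t := {X | ¬¬0 < yCoord X})
    (fun X (hX : 0 < yCoord X) => not_not.mpr hX) ?_ : volume (upperHalf N) = 0)
  rw [← ae_iff]
  filter_upwards [h, h1] with X h2 h3 h4
  refine h2 h4 (h3 ?_)
  have hXA : yCoord X ∈ A := by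
    rcases hA with rfl | rfl
    exacts [Set.mem_univ _, h4]
  have := mul_pos hc (prodFun_weights_pos (a := a) h4.ne' hXA)
  simpa using this

lemma toLp_eigenN_ne_zero (hc : 0 < c) (hA : IsRange A) (p : Index N)
    (h : MemLp (eigenN a p) 2 (muOn N c A a)) : h.toLp ≠ 0 :=
  toLp_ne_zero_of_ae hc hA h ((ae_eigenN_ne_zero a p).mono fun _ hX _ => hX)

lemma toLp_eigenOddOn_ne_zero (hc : 0 < c) (hA : IsRange A) (p : Index N)
    (h : MemLp (eigenOddOn A a p) 2 (muOn N c A a)) : h.toLp ≠ 0 := by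
  refine toLp_ne_zero_of_ae hc hA h ((ae_eigenN_ne_zero (2 - a) p).mono fun X hX hy => ?_)
  refine mul_ne_zero (oddFactor_ne_zero hy.ne' ?_) hX
  rcases hA with rfl | rfl
  exacts [Set.mem_univ _, hy]

/-! ### Indices with a given eigenvalue -/

lemma finite_index_le (r : ℝ) : {p : Index N | (∑ i, (p.1 i : ℝ)) / 2 + p.2 ≤ r}.Finite := by
  -- Each `α i` enters the sum halved, hence the bound `2 * r`; since `r ≥ 0` whenever an index
  -- exists, it also bounds `m`.
  obtain ⟨M, hM⟩ := exists_nat_gt (2 * r)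
  refine ((Set.finite_Iic (fun _ : Fin N => M)).prod (Set.finite_Iic M)).subset fun p hp => ?_
  have hp' : (∑ i, (p.1 i : ℝ)) / 2 + p.2 ≤ r := hp
  have h0 : 0 ≤ ∑ i, (p.1 i : ℝ) := Finset.sum_nonneg fun i _ => Nat.cast_nonneg _
  have h1 : (0 : ℝ) ≤ p.2 := Nat.cast_nonneg _
  refine ⟨fun i => ?_, ?_⟩
  · have h2 := Finset.single_le_sum (f := fun i => (p.1 i : ℝ)) (fun i _ => Nat.cast_nonneg _)
      (Finset.mem_univ i)
    have h3 : (p.1 i : ℝ) ≤ M := by linarith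
    exact_mod_cast h3
  · have h3 : (p.2 : ℝ) ≤ M := by linarith
    exact_mod_cast h3

lemma finite_lamN (κ : ℝ) : {p : Index N | ∑ k, lamN p k = κ}.Finite :=
  (finite_index_le κ).subset fun p (hp : ∑ k, lamN p k = κ) => by
    rw [sum_lamN, kappaN] at hp
    push_cast at hp
    exact hp.le

lemma finite_lamD (a κ : ℝ) : {p : Index N | ∑ k, lamD a p k = κ}.Finite :=
  (finite_index_le (κ - (1 - a) / 2)).subset fun p (hp : ∑ k, lamD a p k = κ) => by
    rw [sum_lamD, kappaD] at hp
    push_cast at hp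
    have : (∑ i, (p.1 i : ℝ)) / 2 + p.2 ≤ κ - (1 - a) / 2 := by linarith
    exact this

lemma indexN_eq (κ : ℝ) : indexN N κ = {p | ∑ k, lamN p k = κ} := by
  simp only [indexN, sum_lamN]

lemma indexD_eq (a κ : ℝ) : indexD N a κ = {p | ∑ k, lamD a p k = κ} := by
  simp only [indexD, sum_lamD]

/-- This is where `N ≥ 1` is used: the whole degree is placed on one coordinate. -/
lemma exists_sum_eq (hN : 1 ≤ N) (n : ℕ) : ∃ α : Fin N → ℕ, ∑ i, α i = n :=
  ⟨Pi.single ⟨0, hN⟩ n, by simp⟩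

lemma exists_lamN_iff (hN : 1 ≤ N) (κ : ℝ) :
    (∃ p : Index N, κ = ∑ k, lamN p k) ↔ ∃ n m : ℕ, κ = kappaN n m := by
  simp only [sum_lamN]
  constructor
  · rintro ⟨p, hp⟩
    exact ⟨_, _, hp⟩
  · rintro ⟨n, m, h⟩
    obtain ⟨α, hα⟩ := exists_sum_eq hN n
    exact ⟨(α, m), by simpa [hα] using h⟩

lemma exists_lamD_iff (hN : 1 ≤ N) (a κ : ℝ) :
    (∃ p : Index N, κ = ∑ k, lamD a p k) ↔ ∃ n m : ℕ, κ = kappaD a n m := by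
  simp only [sum_lamD]
  constructor
  · rintro ⟨p, hp⟩
    exact ⟨_, _, hp⟩
  · rintro ⟨n, m, h⟩
    obtain ⟨α, hα⟩ := exists_sum_eq hN n
    exact ⟨(α, m), by simpa [hα] using h⟩

/-- Equality would make `a` an integer in `(-1, 1)`, hence `0`. -/
lemma kappaN_ne_kappaD (ha : a ∈ Set.Ioo (-1 : ℝ) 1) (h0 : a ≠ 0) (n m n' m' : ℕ) :
    kappaN n m ≠ kappaD a n' m' := by
  intro h
  simp only [kappaN, kappaD] at h
  have h1 : a = ((n' + 2 * m' + 1 - n - 2 * m : ℤ) : ℝ) := by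
    push_cast
    linarith
  obtain ⟨h2, h3⟩ := ha
  rw [h1] at h2 h3 h0
  have h4 : (-1 : ℤ) < n' + 2 * m' + 1 - n - 2 * m := by exact_mod_cast h2
  have h5 : (n' + 2 * m' + 1 - n - 2 * m : ℤ) < 1 := by exact_mod_cast h3
  have h6 : (n' + 2 * m' + 1 - n - 2 * m : ℤ) ≠ 0 := by exact_mod_cast h0
  omega

lemma eigenOddOn_univ (a : ℝ) (p : Index N) : (eigenOddOn Set.univ a p : Space N → ℝ)
    = eigenOdd a p := by
  funext X
  rw [eigenOddOn, oddFactor, chi_of_mem (Set.mem_univ _), eigenOdd, eigenN,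
    show (2 - a - 1) / 2 = (1 - a) / 2 by ring]
  ring

/-- The two functions may differ for `y ≤ 0`, a null set for the measure; for `y > 0` one has
`y|y|^{-a} = y^{1-a}`. -/
lemma eigenOddOn_half_ae_eq (a : ℝ) (p : Index N) :
    (eigenOddOn (Set.Ioi 0) a p : Space N → ℝ) =ᵐ[muOn N c (Set.Ioi 0) a] eigenD a p := by
  have hm := measurable_prodFun (measurable_weights (N := N) (A := Set.Ioi 0) (Or.inr rfl) a)
  rw [Filter.EventuallyEq, muOn, muProd, ae_withDensity_iff (by fun_prop)]
  refine Filter.Eventually.of_forall fun X hX => ?_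
  have hy : 0 < yCoord X := by
    by_contra hXA
    rw [prodFun_weights, chi_of_notMem (by simpa using hXA)] at hX
    simp at hX
  rw [eigenOddOn, oddFactor, chi_of_mem (Set.mem_Ioi.mpr hy), eigenD, eigenN,
    show (2 - a - 1) / 2 = (1 - a) / 2 by ring, abs_of_pos hy, sub_eq_add_neg 1 a,
    Real.rpow_add hy, Real.rpow_one]
  ring

end Completeness

/-! ### The Neumann, Dirichlet and whole-space problems. -/

theorem neumann_half {N : ℕ} (hN : 1 ≤ N) {a : ℝ} (ha : -1 < a) :
    ∃ hV : ∀ p, MemLp (eigenN a p) 2 (muHalf N a),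
      eigenvalues (muHalf N a) Set.univ = {κ | ∃ n m : ℕ, κ = kappaN n m} ∧
      (∀ κ, FiniteDimensional ℝ (weakEigenspace (muHalf N a) Set.univ κ)) ∧
      (∀ n₀ m₀ : ℕ, weakEigenspace (muHalf N a) Set.univ (kappaN n₀ m₀) =
          Submodule.span ℝ ((fun p => (hV p).toLp) '' indexN N (kappaN n₀ m₀))) ∧
      IsOrthogonalBasis (fun p => (hV p).toLp) := by
  rw [muHalf_eq]
  have hc := normConst_pos (N := N) ha
  have hA : IsRange (Set.Ioi 0) := Or.inr rfl
  have hV := memLp_eigenN (N := N) hc hA ha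
  have hM := fun p => isMode_eigenN hc hA ha p (hV p)
  have h0 := fun p => toLp_eigenN_ne_zero hc hA p (hV p)
  have hd := eq_zero_of_orthogonal_eigenN_half hc ha hV
  refine ⟨hV, ?_, fun κ => finiteDimensional_weakEigenspace_of_isMode hM hd (finite_lamN κ),
    fun n m => ?_, isOrthogonalBasis_of_isMode hM injective_lamN h0 hd⟩
  · rw [eigenvalues_eq_of_isMode hM h0 hd]
    exact Set.ext (exists_lamN_iff hN)
  · rw [indexN_eq]
    exact weakEigenspace_eq_span_of_isMode hM hd (finite_lamN _)

theorem dirichlet_half {N : ℕ} (hN : 1 ≤ N) {a : ℝ} (ha : a ∈ Set.Ioo (-1 : ℝ) 1) :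
    ∃ hV : ∀ p, MemLp (eigenD a p) 2 (muHalf N a),
      eigenvalues (muHalf N a) (upperHalf N) = {κ | ∃ n m : ℕ, κ = kappaD a n m} ∧
      (∀ κ, FiniteDimensional ℝ (weakEigenspace (muHalf N a) (upperHalf N) κ)) ∧
      (∀ n₀ m₀ : ℕ, weakEigenspace (muHalf N a) (upperHalf N) (kappaD a n₀ m₀) =
          Submodule.span ℝ ((fun p => (hV p).toLp) '' indexD N a (kappaD a n₀ m₀))) ∧
      IsOrthogonalBasis (fun p => (hV p).toLp) := by
  rw [muHalf_eq]
  have hc := normConst_pos (N := N) ha.1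
  have hA : IsRange (Set.Ioi 0) := Or.inr rfl
  have hW := memLp_eigenOddOn (N := N) hc hA ha.2
  have hV := fun p => (hW p).ae_eq (eigenOddOn_half_ae_eq (c := normConst N a) a p)
  have hVW : (fun p => (hV p).toLp) = fun p => (hW p).toLp := funext fun p =>
    (MemLp.toLp_eq_toLp_iff _ _).mpr (eigenOddOn_half_ae_eq a p).symm
  have hM := fun p => isMode_eigenOddOn hc (Or.inr ⟨rfl, rfl⟩) ha.2 p (hW p)
  have h0 := fun p => toLp_eigenOddOn_ne_zero hc hA p (hW p)
  have hd := eq_zero_of_orthogonal_eigenOddOn_half hc ha.2 hW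
  refine ⟨hV, ?_⟩
  rw [hVW]
  refine ⟨?_, fun κ => finiteDimensional_weakEigenspace_of_isMode hM hd (finite_lamD a κ),
    fun n m => ?_, isOrthogonalBasis_of_isMode hM (injective_lamD a) h0 hd⟩
  · rw [eigenvalues_eq_of_isMode hM h0 hd]
    exact Set.ext (exists_lamD_iff hN a)
  · rw [indexD_eq]
    exact weakEigenspace_eq_span_of_isMode hM hd (finite_lamD a _)

theorem whole_space {N : ℕ} (hN : 1 ≤ N) {a : ℝ} (ha : a ∈ Set.Ioo (-1 : ℝ) 1) :
    ∃ (hV : ∀ p, MemLp (eigenN a p) 2 (muWhole N a))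
      (hW : ∀ p, MemLp (eigenOdd a p) 2 (muWhole N a)),
      eigenvalues (muWhole N a) Set.univ =
          {κ | ∃ n m : ℕ, κ = kappaD a n m} ∪ {κ | ∃ n m : ℕ, κ = kappaN n m} ∧
      (∀ κ, FiniteDimensional ℝ (weakEigenspace (muWhole N a) Set.univ κ)) ∧
      (∀ κ : ℝ, weakEigenspace (muWhole N a) Set.univ κ =
          Submodule.span ℝ ((fun p => (hV p).toLp) '' indexN N κ) ⊔
          Submodule.span ℝ ((fun p => (hW p).toLp) '' indexD N a κ)) ∧
      IsOrthogonalBasis (Sum.elim (fun p => (hV p).toLp) (fun p => (hW p).toLp)) := by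
  rw [muWhole_eq]
  have hc : 0 < normConst N a / 2 := half_pos (normConst_pos ha.1)
  have hA : IsRange Set.univ := Or.inl rfl
  have hV := memLp_eigenN (N := N) hc hA ha.1
  have hW := memLp_eigenOddOn (N := N) hc hA ha.2
  have hMV := fun p => isMode_eigenN hc hA ha.1 p (hV p)
  have hMW := fun p => isMode_eigenOddOn hc (Or.inl ⟨rfl, rfl⟩) ha.2 p (hW p)
  have hdVW := eq_zero_of_orthogonal_whole hc ha hV hW
  have h0W := fun p => toLp_eigenOddOn_ne_zero hc hA p (hW p)
  have hE : ∀ p : Index N, (eigenOddOn Set.univ a p : Space N → ℝ) = eigenOdd a p :=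
    eigenOddOn_univ a
  -- The `L²` classes depend on the membership proofs, so everything is generalized before the
  -- function is rewritten in its explicit form.
  revert hdVW hMW h0W hW
  simp only [hE]
  intro hW hMW hdVW h0W
  set e : Index N ⊕ Index N → Lp ℝ 2 (muOn N (normConst N a / 2) Set.univ a) :=
    Sum.elim (fun p => (hV p).toLp) (fun p => (hW p).toLp) with he
  set lam : Index N ⊕ Index N → Fin (N + 1) → ℝ := Sum.elim lamN (lamD a) with hlam
  have hM : ∀ i, IsMode (muOn N (normConst N a / 2) Set.univ a) Set.univ (e i) (lam i) := by
    rintro (p | p)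
    exacts [hMV p, hMW p]
  -- Injectivity on the disjoint union contains the orthogonality of even and odd modes, with no
  -- parity computation.
  have hinj : Function.Injective lam :=
    injective_lamN.sumElim (injective_lamD a) (lamN_ne_lamD ha)
  have h0 : ∀ i, e i ≠ 0 := by
    rintro (p | p)
    exacts [toLp_eigenN_ne_zero hc hA p (hV p), h0W p]
  have hd : ∀ f, (∀ i, inner ℝ (e i) f = 0) → f = 0 := fun f hf =>
    hdVW f (fun p => hf (Sum.inl p)) fun p => hf (Sum.inr p)
  have hset : ∀ κ, {i | ∑ k, lam i k = κ}
      = Sum.inl '' indexN N κ ∪ Sum.inr '' indexD N a κ := by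
    intro κ
    rw [indexN_eq, indexD_eq]
    ext (p | p) <;> simp [hlam]
  have hfin : ∀ κ, {i | ∑ k, lam i k = κ}.Finite := by
    intro κ
    rw [hset, indexN_eq, indexD_eq]
    exact ((finite_lamN κ).image _).union ((finite_lamD a κ).image _)
  refine ⟨hV, hW, ?_, fun κ => finiteDimensional_weakEigenspace_of_isMode hM hd (hfin κ),
    fun κ => ?_, isOrthogonalBasis_of_isMode hM hinj h0 hd⟩
  · rw [eigenvalues_eq_of_isMode hM h0 hd, Set.union_comm]
    ext κ
    refine Iff.trans ?_ (or_congr (exists_lamN_iff hN κ) (exists_lamD_iff hN a κ))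
    exact Sum.exists
  · rw [weakEigenspace_eq_span_of_isMode hM hd (hfin κ), hset, Set.image_union,
      Submodule.span_union, Set.image_image, Set.image_image]
    rfl

end OrnsteinUhlenbeck

end

theorem mainTheorem7 (N : ℕ) (hN : 1 ≤ N) (a : ℝ) (ha : a ∈ Set.Ioo (-1 : ℝ) 1) :
    -- (i) the Neumann problem on the half-space
    (∃ hV : ∀ p, MemLp (eigenN a p) 2 (muHalf N a),
      eigenvalues (muHalf N a) Set.univ =
          {κ | ∃ n m : ℕ, κ = kappaN n m} ∧
      (∀ κ, FiniteDimensional ℝ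
        (weakEigenspace (muHalf N a) Set.univ κ)) ∧
      (∀ n₀ m₀ : ℕ,
        weakEigenspace (muHalf N a) Set.univ
            (kappaN n₀ m₀) =
          Submodule.span ℝ ((fun p => (hV p).toLp) ''
            indexN N (kappaN n₀ m₀))) ∧
      IsOrthogonalBasis (fun p => (hV p).toLp)) ∧
    -- (ii) the Dirichlet problem on the half-space
    (∃ hV : ∀ p, MemLp (eigenD a p) 2 (muHalf N a),
      eigenvalues (muHalf N a)
            (upperHalf N) =
          {κ | ∃ n m : ℕ, κ = kappaD a n m} ∧
      (∀ κ, FiniteDimensional ℝ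
        (weakEigenspace (muHalf N a)
          (upperHalf N) κ)) ∧
      (∀ n₀ m₀ : ℕ,
        weakEigenspace (muHalf N a)
            (upperHalf N) (kappaD a n₀ m₀) =
          Submodule.span ℝ ((fun p => (hV p).toLp) ''
            indexD N a (kappaD a n₀ m₀))) ∧
      IsOrthogonalBasis (fun p => (hV p).toLp)) ∧
    -- (iii) the problem on the whole space
    (∃ (hV : ∀ p, MemLp (eigenN a p) 2 (muWhole N a))
       (hW : ∀ p, MemLp (eigenOdd a p) 2 (muWhole N a)),
      eigenvalues (muWhole N a) Set.univ =
          {κ | ∃ n m : ℕ, κ = kappaD a n m} ∪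
          {κ | ∃ n m : ℕ, κ = kappaN n m} ∧
      (∀ κ, FiniteDimensional ℝ
        (weakEigenspace (muWhole N a) Set.univ κ)) ∧
      (∀ κ : ℝ,
        weakEigenspace (muWhole N a) Set.univ κ =
          Submodule.span ℝ ((fun p => (hV p).toLp) '' indexN N κ) ⊔
          Submodule.span ℝ ((fun p => (hW p).toLp) '' indexD N a κ)) ∧
      (a ≠ 0 → ∀ n₀ m₀ : ℕ,
        weakEigenspace (muWhole N a) Set.univ
            (kappaN n₀ m₀) =
          Submodule.span ℝ ((fun p => (hV p).toLp) ''
            indexN N (kappaN n₀ m₀)) ∧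
        weakEigenspace (muWhole N a) Set.univ
            (kappaD a n₀ m₀) =
          Submodule.span ℝ ((fun p => (hW p).toLp) ''
            indexD N a (kappaD a n₀ m₀))) ∧
      IsOrthogonalBasis
        (Sum.elim (fun p => (hV p).toLp) (fun p => (hW p).toLp))) := by
  refine ⟨neumann_half hN ha.1, dirichlet_half hN ha, ?_⟩
  obtain ⟨hV, hW, h1, h2, h3, h4⟩ := whole_space hN ha
  refine ⟨hV, hW, h1, h2, h3, fun h0 n m => ⟨?_, ?_⟩, h4⟩
  -- For `a ≠ 0` the two kinds of eigenvalues never meet, so one of the two spans is trivial.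
  · have h5 : indexD N a (kappaN n m) = ∅ :=
      Set.eq_empty_of_forall_notMem fun p hp => kappaN_ne_kappaD ha h0 n m _ _ hp.symm
    rw [h3, h5, Set.image_empty, Submodule.span_empty, sup_bot_eq]
  · have h5 : indexN N (kappaD a n m) = ∅ :=
      Set.eq_empty_of_forall_notMem fun p hp => kappaN_ne_kappaD ha h0 _ _ n m hp
    rw [h3, h5, Set.image_empty, Submodule.span_empty, bot_sup_eq]
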